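/- Let $n\ge 0$. Let $\mathcal F_n$ be the group generated by $\zeta_1,\dots,\zeta_{n-1}$ (classical generators) and $\tau_1,\dots,\tau_{n-1}$ (virtual generators) subject to 1. $\tau_i^2=1$ and $\zeta_i^2=1$; 2. $\tau_i\zeta_i=\zeta_i\tau_i$; 3. $\zeta_i\zeta_j=\zeta_j\zeta_i$, $\zeta_i\tau_j=\tau_j\zeta_i$, $\tau_i\tau_j=\tau_j\tau_i$ for $|i-j|\ge 2$; 4. $\tau_i\tau_{i+1}\tau_i=\tau_{i+1}\tau_i\tau_{i+1}$; 5. $\tau_i\tau_{i+1}\zeta_i=\zeta_{i+1}\tau_i\tau_{i+1}$, and let the free braid group $\mathcal{FB}_n$ be the quotient of $\mathcal F_n$ by the relations $\zeta_i\zeta_{i+1}\zeta_i=\zeta_{i+1}\zeta_i\zeta_{i+1}$. A braid-word is a finite word in the letters $\zeta_i,\tau_i$; its classical crossings are the occurrences of letters $\zeta_i$. Two braid-words are strongly equivalent if they are connected by finitely many applications (in either direction, to blocks of consecutive letters) of the defining relations of $\mathcal F_n$ other than $\zeta_i^2=1$. Draw a braid-word from top to bottom as a diagram of $n$ strands, numbered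 by their upper ends, in which each letter $\zeta_i$ or $\tau_i$ makes the strands at positions $i$ and $i+1$ cross. Two distinct classical crossings form a bigon if they lie on the same two strands and no classical crossing between them in the word lies on either of these two strands; a bigon reduction deletes two such crossings. A braid-word is irreducible if it admits no bigon reduction. Let $B\subseteq\mathcal{FB}_n$. A parity for $B$ assigns an element of $\mathbb Z_2$ ($0$ is even, $1$ is odd) to every classical crossing of every braid-word that represents an element of $B$, such that, whenever a word $AuC$ representing an element of $B$ is changed to $AvC$ by a defining relation $u=v$ of $\mathcal{FB}_n$ as listed above: * all classical crossings in $A$ and $C$ keep their parity; * for $\zeta_i\zeta_j=\zeta_j\zeta_i$ ($|i-j|\ge2$) the parity of $\zeta_i$ and that of $\zeta_j$ are the same on both sides; for $\zeta_i\tau_j=\tau_j\zeta_i$ ($|i-j|\ge 2$) and $\zeta_i\tau_i=\tau_i\zeta_i$ the parity of $\zeta_i$ is the same on both sides; * for $\tau_i\tau_{i+1}\zeta_i=\zeta_{i+1}\tau_i\tau_{i+1}$ the classical crossings on the two sides have the same parity; * for $\zeta_i^2=1$ the two crossings on the left have the same parity; * for $\zeta_i\zeta_{i+1}\zeta_i=\zeta_{i+1}\zeta_i\zeta_{i+1}$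 the number of odd crossings on the left is even, and the first, second and third crossing on the left have the same parities as the third, second and first crossing on the right, respectively. **Theorem.** Let $p$ be a parity for a set $B$ of free $n$-strand braids. Let $\beta$ be an irreducible braid-word which represents an element of $B$ and all of whose classical crossings are odd with respect to $p$. Then every braid-word $\beta'$ that is equal to $\beta$ in $\mathcal{FB}_n$ (in particular, every $\beta'$ equal to $\beta$ in $\mathcal F_n$) contains a subword (a word obtained by deleting some, possibly no, letters, not necessarily consecutive ones) that is strongly equivalent to $\beta$. -/

import Mathlib

namespace FreeBraid

/-- The generators of the free braid groups on `n` strands: the classical generators `zeta i` and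
the virtual generators `tau i`, with `n - 1` of each (indexed from `0` instead of `1`). -/
inductive Letter (n : ℕ) : Type
  | zeta (i : Fin (n - 1)) : Letter n
  | tau (i : Fin (n - 1)) : Letter n

open Letter

/-- An `n`-strand free braid-word, read from the top to the bottom. -/
abbrev Word (n : ℕ) : Type := List (Letter n)

/-- The condition `|i - j| ≥ 2`. -/
def Far {n : ℕ} (i j : Fin (n - 1)) : Prop :=
  (i : ℕ) + 2 ≤ (j : ℕ) ∨ (j : ℕ) + 2 ≤ (i : ℕ)

/-- `j = i + 1`. -/
def Next {n : ℕ} (i j : Fin (n - 1)) : Prop := (i : ℕ) + 1 = (j : ℕ)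

/-- The defining relations of `F n`, except the classical second Reidemeister move. -/
inductive StrongRel (n : ℕ) : Word n → Word n → Prop
  | virtualSecond (i : Fin (n - 1)) : StrongRel n [tau i, tau i] []
  | virtualization (i : Fin (n - 1)) : StrongRel n [zeta i, tau i] [tau i, zeta i]
  | farZetaZeta (i j : Fin (n - 1)) (h : Far i j) : StrongRel n [zeta i, zeta j] [zeta j, zeta i]
  | farZetaTau (i j : Fin (n - 1)) (h : Far i j) : StrongRel n [zeta i, tau j] [tau j, zeta i]
  | farTauTau (i j : Fin (n - 1)) (h : Far i j) : StrongRel n [tau i, tau j] [tau j, tau i]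
  | virtualThird (i j : Fin (n - 1)) (h : Next i j) :
      StrongRel n [tau i, tau j, tau i] [tau j, tau i, tau j]
  | semivirtualThird (i j : Fin (n - 1)) (h : Next i j) :
      StrongRel n [tau i, tau j, zeta i] [zeta j, tau i, tau j]

/-- The defining relations of the group `F n`. -/
inductive FRel (n : ℕ) : Word n → Word n → Prop
  | strong {u v : Word n} (h : StrongRel n u v) : FRel n u v
  | classicalSecond (i : Fin (n - 1)) : FRel n [zeta i, zeta i] []

/-- The third Reidemeister moves. -/
inductive ThirdRel (n : ℕ) : Word n → Word n → Prop
  | classicalThird (i j : Fin (n - 1)) (h : Next i j) :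
      ThirdRel n [zeta i, zeta j, zeta i] [zeta j, zeta i, zeta j]

/-- The full list of defining relations of the free braid group `FB n`. -/
inductive FBRel (n : ℕ) : Word n → Word n → Prop
  | ofF {u v : Word n} (h : FRel n u v) : FBRel n u v
  | third {u v : Word n} (h : ThirdRel n u v) : FBRel n u v

/-- The element of the free group on the letters spelled by a word. -/
def toFreeGroup {n : ℕ} (w : Word n) : FreeGroup (Letter n) := (w.map FreeGroup.of).prod

/-- The group `F n` with generators `zeta i`, `tau i` and the relations `FRel n`. -/
abbrev F (n : ℕ) : Type :=
  PresentedGroup {r : FreeGroup (Letter n) |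
    ∃ u v : Word n, FRel n u v ∧ r = toFreeGroup u * (toFreeGroup v)⁻¹}

/-- The element of `F n` represented by a word. -/
def toF {n : ℕ} (w : Word n) : F n := PresentedGroup.mk _ (toFreeGroup w)

/-- The free `n`-strand braid group: the quotient of `F n` by the third Reidemeister moves. -/
abbrev FB (n : ℕ) : Type :=
  F n ⧸ Subgroup.normalClosure {r : F n |
    ∃ u v : Word n, ThirdRel n u v ∧ r = toF u * (toF v)⁻¹}

/-- The free braid represented by a word. -/
def toFB {n : ℕ} (w : Word n) : FB n := QuotientGroup.mk (toF w)

/-- Two words differ by one strong move: a defining relation of `F n` other than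
`zeta i * zeta i = 1` is applied to a block of consecutive letters. -/
def StrongMove {n : ℕ} (w w' : Word n) : Prop :=
  ∃ A u v C : Word n, StrongRel n u v ∧ w = A ++ u ++ C ∧ w' = A ++ v ++ C

/-- Strong equivalence of words: finitely many strong moves and their inverses. -/
def StronglyEquivalent {n : ℕ} (w w' : Word n) : Prop := Relation.EqvGen StrongMove w w'

/-- The left one of the two positions exchanged by the `i`-th generators. -/
def leftPos {n : ℕ} (i : Fin (n - 1)) : Fin n := ⟨i, by omega⟩

/-- The right one of the two positions exchanged by the `i`-th generators. -/
def rightPos {n : ℕ} (i : Fin (n - 1)) : Fin n := ⟨i + 1, by omega⟩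

/-- The transposition of positions made by a crossing, classical or virtual. -/
def Letter.swap {n : ℕ} : Letter n → Equiv.Perm (Fin n)
  | zeta i => Equiv.swap (leftPos i) (rightPos i)
  | tau i => Equiv.swap (leftPos i) (rightPos i)

/-- `strandAt w k` is the strand, numbered by its upper end, which is at position `k` just below
the diagram of `w`. -/
def strandAt {n : ℕ} (w : Word n) : Equiv.Perm (Fin n) := (w.map Letter.swap).prod

/-- The two strands which meet in the crossing `zeta i` of a word `A ++ zeta i :: C`; they do not
depend on `C`. -/
def strands {n : ℕ} (A : Word n) (i : Fin (n - 1)) : Finset (Fin n) :=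
  {strandAt A (leftPos i), strandAt A (rightPos i)}

/-- `w'` is obtained from `w` by a bigon reduction: two classical crossings of `w` lie on the same
two strands, no classical crossing between them lies on either of these strands, and `w'` is the
result of deleting the two crossings. -/
def BigonReduction {n : ℕ} (w w' : Word n) : Prop :=
  ∃ (A : Word n) (i : Fin (n - 1)) (M : Word n) (j : Fin (n - 1)) (C : Word n),
    w = A ++ zeta i :: (M ++ zeta j :: C) ∧
    w' = A ++ (M ++ C) ∧
    strands (A ++ zeta i :: M) j = strands A i ∧
    ∀ (M₁ : Word n) (k : Fin (n - 1)) (M₂ : Word n), M = M₁ ++ zeta k :: M₂ →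
      Disjoint (strands (A ++ zeta i :: M₁) k) (strands A i)

/-- A word is irreducible if it admits no bigon reduction. -/
def IsIrreducible {n : ℕ} (w : Word n) : Prop := ∀ w' : Word n, ¬ BigonReduction w w'

/-- A parity for the free braids of a class `B`. A classical crossing of a word is given by the
part `A` of the word above it, its letter `zeta i`, and the part `C` below it; `val A i C` is the
parity of this crossing of the word `A ++ zeta i :: C` (`0` is even, `1` is odd). Only the values on
words which represent braids of `B` matter: nothing is asked of the others. -/
structure Parity {n : ℕ} (B : Set (FB n)) where
  val : Word n → Fin (n - 1) → Word n → ZMod 2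
  /-- Crossings above the place where a relation is applied keep their parity. -/
  above (A₁ : Word n) (k : Fin (n - 1)) (A₂ u v C : Word n) (h : FBRel n u v)
    (hB : toFB ((A₁ ++ zeta k :: A₂) ++ u ++ C) ∈ B) :
    val A₁ k (A₂ ++ u ++ C) = val A₁ k (A₂ ++ v ++ C)
  /-- Crossings below the place where a relation is applied keep their parity. -/
  below (A u v C₁ : Word n) (k : Fin (n - 1)) (C₂ : Word n) (h : FBRel n u v)
    (hB : toFB (A ++ u ++ (C₁ ++ zeta k :: C₂)) ∈ B) :
    val (A ++ u ++ C₁) k C₂ = val (A ++ v ++ C₁) k C₂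
  /-- `ζᵢ ζⱼ → ζⱼ ζᵢ`: the crossing `ζᵢ`. -/
  farZetaZeta_left (A C : Word n) (i j : Fin (n - 1)) (h : Far i j)
    (hB : toFB (A ++ [zeta i, zeta j] ++ C) ∈ B) :
    val A i (zeta j :: C) = val (A ++ [zeta j]) i C
  /-- `ζᵢ ζⱼ → ζⱼ ζᵢ`: the crossing `ζⱼ`. -/
  farZetaZeta_right (A C : Word n) (i j : Fin (n - 1)) (h : Far i j)
    (hB : toFB (A ++ [zeta i, zeta j] ++ C) ∈ B) :
    val (A ++ [zeta i]) j C = val A j (zeta i :: C)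
  /-- `ζᵢ τⱼ → τⱼ ζᵢ`. -/
  farZetaTau (A C : Word n) (i j : Fin (n - 1)) (h : Far i j)
    (hB : toFB (A ++ [zeta i, tau j] ++ C) ∈ B) :
    val A i (tau j :: C) = val (A ++ [tau j]) i C
  /-- `ζᵢ ζᵢ → 1`. -/
  classicalSecond (A C : Word n) (i : Fin (n - 1))
    (hB : toFB (A ++ [zeta i, zeta i] ++ C) ∈ B) :
    val A i (zeta i :: C) = val (A ++ [zeta i]) i C
  /-- `ζᵢ ζⱼ ζᵢ → ζⱼ ζᵢ ζⱼ`, `j = i + 1`: the number of odd crossings is even. -/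
  classicalThird_sum (A C : Word n) (i j : Fin (n - 1)) (h : Next i j)
    (hB : toFB (A ++ [zeta i, zeta j, zeta i] ++ C) ∈ B) :
    val A i (zeta j :: zeta i :: C) + val (A ++ [zeta i]) j (zeta i :: C)
      + val (A ++ [zeta i, zeta j]) i C = 0
  /-- `ζᵢ ζⱼ ζᵢ → ζⱼ ζᵢ ζⱼ`, `j = i + 1`: the upper crossing on the left, the lower one on the
  right. -/
  classicalThird_upper (A C : Word n) (i j : Fin (n - 1)) (h : Next i j)
    (hB : toFB (A ++ [zeta i, zeta j, zeta i] ++ C) ∈ B) :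
    val A i (zeta j :: zeta i :: C) = val (A ++ [zeta j, zeta i]) j C
  /-- `ζᵢ ζⱼ ζᵢ → ζⱼ ζᵢ ζⱼ`, `j = i + 1`: the middle crossings. -/
  classicalThird_middle (A C : Word n) (i j : Fin (n - 1)) (h : Next i j)
    (hB : toFB (A ++ [zeta i, zeta j, zeta i] ++ C) ∈ B) :
    val (A ++ [zeta i]) j (zeta i :: C) = val (A ++ [zeta j]) i (zeta j :: C)
  /-- `ζᵢ ζⱼ ζᵢ → ζⱼ ζᵢ ζⱼ`, `j = i + 1`: the lower crossing on the left, the upper one on the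
  right. -/
  classicalThird_lower (A C : Word n) (i j : Fin (n - 1)) (h : Next i j)
    (hB : toFB (A ++ [zeta i, zeta j, zeta i] ++ C) ∈ B) :
    val (A ++ [zeta i, zeta j]) i C = val A j (zeta i :: zeta j :: C)
  /-- `τᵢ τⱼ ζᵢ → ζⱼ τᵢ τⱼ`, `j = i + 1`. -/
  semivirtualThird (A C : Word n) (i j : Fin (n - 1)) (h : Next i j)
    (hB : toFB (A ++ [tau i, tau j, zeta i] ++ C) ∈ B) :
    val (A ++ [tau i, tau j]) i C = val A j (tau i :: tau j :: C)
  /-- `ζᵢ τᵢ → τᵢ ζᵢ`. -/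
  virtualization (A C : Word n) (i : Fin (n - 1))
    (hB : toFB (A ++ [zeta i, tau i] ++ C) ∈ B) :
    val A i (tau i :: C) = val (A ++ [tau i]) i C

/-- All classical crossings of the word `w` are odd. -/
def Parity.AllOdd {n : ℕ} {B : Set (FB n)} (p : Parity B) (w : Word n) : Prop :=
  ∀ (A : Word n) (i : Fin (n - 1)) (C : Word n), w = A ++ zeta i :: C → p.val A i C = 1

end FreeBraid

/-! The proof has three ingredients: a parity projection to `F n`, a normal form for crossings, and
a reconstruction of a word from its crossings.

Deleting the even classical crossings turns every relation of `FB n` into an identity of `F n`. The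
critical case is a third move. It has zero or two odd crossings, and its two sides leave either the
same word or the trivial words `ζᵢ ζᵢ` and `ζⱼ ζⱼ`. So words that are equal in `FB n` and represent
an element of `B` have images under `keepOdd` that are equal in `F n` (`toF_keepOdd_eq`). Since `β`
is its own image, the subword of `β'` left by this deletion equals `β` in `F n`.

In `F n`, attach to a word its permutation and the list of pairs of strands meeting in its classical
crossings. The relations of `F n` change the list only by exchanging neighbouring disjoint pairs and
by cancelling equal neighbours, so the list defines an element of a right-angled Coxeter group. A
bigon reduction keeps this element and the permutation (`crossingCon_of_bigonReduction`). An
irreducible word has a reduced list, and two reduced lists of the same element differ only by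
exchanges. Hence an irreducible `γ`, obtained from the subword by bigon reductions, shares its
permutation with `β`, and its crossings up to exchanges.

These data determine a word up to strong equivalence (`stronglyEquivalent_of_crossings`). The `τᵢ`
satisfy the relations of the symmetric group, and the conjugate of `ζᵢ τᵢ` by a permutation depends
only on the resulting pair of strands (`conj_eq_of_pairAt_eq`). Moving all `τᵢ` to the right writes
a word as a product of one such conjugate per crossing, times its permutation; conjugates for
disjoint pairs commute. -/

namespace FreeBraid

open Letter

/-! ### Equality in the presented groups and congruences on words -/

section Presentation

variable {n : ℕ}

theorem toFreeGroup_append (u v : Word n) :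
    toFreeGroup (u ++ v) = toFreeGroup u * toFreeGroup v := by
  simp [toFreeGroup]

theorem toF_append (u v : Word n) : toF (u ++ v) = toF u * toF v := by
  simp [toF, toFreeGroup_append]

theorem toFB_append (u v : Word n) : toFB (u ++ v) = toFB u * toFB v := by
  simp [toFB, toF_append]

theorem toF_eq_of_rel {u v : Word n} (h : FRel n u v) : toF u = toF v :=
  PresentedGroup.mk_eq_mk_of_mul_inv_mem ⟨u, v, h, rfl⟩

theorem toFB_eq_of_rel {u v : Word n} (h : FBRel n u v) : toFB u = toFB v := by
  cases h with
  | ofF h => exact congrArg QuotientGroup.mk (toF_eq_of_rel h)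
  | third h =>
    have : (QuotientGroup.mk (toF u * (toF v)⁻¹) : FB n) = 1 :=
      (QuotientGroup.eq_one_iff _).2 (Subgroup.subset_normalClosure ⟨u, v, h, rfl⟩)
    rw [QuotientGroup.mk_mul, QuotientGroup.mk_inv, mul_inv_eq_one] at this
    exact this

variable (c : Con (FreeMonoid (Letter n)))
  (hc : ∀ u v : Word n, FRel n u v → c (FreeMonoid.ofList u) (FreeMonoid.ofList v))

include hc in
-- Letters are involutions modulo `c`, hence units of the quotient monoid; this is what lets the
-- presented group map to it.
theorem con_letter_sq (l : Letter n) : c (FreeMonoid.ofList [l, l]) 1 := by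
  cases l with
  | zeta i => exact hc _ _ (.classicalSecond i)
  | tau i => exact hc _ _ (.strong (.virtualSecond i))

/-- A letter as a unit of a quotient of the monoid of words in which the relations of `F n` hold. -/
def letterUnit (l : Letter n) : c.Quotientˣ where
  val := (FreeMonoid.of l : c.Quotient)
  inv := (FreeMonoid.of l : c.Quotient)
  val_inv := (Con.eq c).2 (con_letter_sq c hc l)
  inv_val := (Con.eq c).2 (con_letter_sq c hc l)

theorem lift_letterUnit (w : Word n) :
    ((FreeGroup.lift (letterUnit c hc) (toFreeGroup w) : c.Quotientˣ) : c.Quotient) =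
      (FreeMonoid.ofList w : c.Quotient) := by
  induction w with
  | nil => simp [toFreeGroup]
  | cons l w ih =>
    have h : toFreeGroup (l :: w) = FreeGroup.of l * toFreeGroup w := by simp [toFreeGroup]
    rw [h, map_mul, Units.val_mul, ih, FreeGroup.lift_apply_of]
    rfl

/-- The homomorphism from `F n` to the units of a quotient of the monoid of words in which the
relations of `F n` hold. -/
def homOfCon : F n →* c.Quotientˣ :=
  PresentedGroup.toGroup (f := letterUnit c hc) (by
    rintro r ⟨u, v, h, rfl⟩
    rw [map_mul, map_inv, mul_inv_eq_one]
    ext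
    rw [lift_letterUnit, lift_letterUnit]
    exact (Con.eq c).2 (hc u v h))

theorem homOfCon_toF (w : Word n) :
    (homOfCon c hc (toF w) : c.Quotient) = (FreeMonoid.ofList w : c.Quotient) :=
  lift_letterUnit c hc w

include hc in
/-- A congruence on words which contains the relations of `F n` contains equality in `F n`. -/
theorem con_of_toF_eq {w w' : Word n} (h : toF w = toF w') :
    c (FreeMonoid.ofList w) (FreeMonoid.ofList w') := by
  rw [← Con.eq, ← homOfCon_toF c hc, ← homOfCon_toF c hc, h]

/-- A congruence on words which contains the relations of `FB n` contains equality in `FB n`. -/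
theorem con_of_toFB_eq
    (hc : ∀ u v : Word n, FBRel n u v → c (FreeMonoid.ofList u) (FreeMonoid.ofList v))
    {w w' : Word n} (h : toFB w = toFB w') :
    c (FreeMonoid.ofList w) (FreeMonoid.ofList w') := by
  have hF : ∀ u v : Word n, FRel n u v → c (FreeMonoid.ofList u) (FreeMonoid.ofList v) :=
    fun u v huv => hc u v (.ofF huv)
  have hle : Subgroup.normalClosure {r : F n |
      ∃ u v : Word n, ThirdRel n u v ∧ r = toF u * (toF v)⁻¹} ≤ (homOfCon c hF).ker := by
    refine Subgroup.normalClosure_le_normal ?_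
    rintro r ⟨u, v, huv, rfl⟩
    rw [SetLike.mem_coe, MonoidHom.mem_ker, map_mul, map_inv, mul_inv_eq_one]
    ext
    rw [homOfCon_toF, homOfCon_toF]
    exact (Con.eq c).2 (hc u v (.third huv))
  have h1 := hle (QuotientGroup.eq.1 h)
  rw [MonoidHom.mem_ker, map_mul, map_inv, inv_mul_eq_one] at h1
  rw [← Con.eq, ← homOfCon_toF c hF, ← homOfCon_toF c hF, h1]

end Presentation

/-! ### Deletion of even crossings -/

section Keep

variable {n : ℕ}

/-- The middle part `w` of the word `A ++ w ++ C` after deleting its even classical crossings. -/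
def keepOdd (f : Word n → Fin (n - 1) → Word n → ZMod 2) : Word n → Word n → Word n → Word n
  | _, [], _ => []
  | A, zeta i :: w, C =>
    if f A i (w ++ C) = 0 then keepOdd f (A ++ [zeta i]) w C
    else zeta i :: keepOdd f (A ++ [zeta i]) w C
  | A, tau i :: w, C => tau i :: keepOdd f (A ++ [tau i]) w C

variable (f : Word n → Fin (n - 1) → Word n → ZMod 2)

theorem keepOdd_append (A u v C : Word n) :
    keepOdd f A (u ++ v) C = keepOdd f A u (v ++ C) ++ keepOdd f (A ++ u) v C := by
  induction u generalizing A with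
  | nil => simp [keepOdd]
  | cons l u ih =>
    cases l with
    | zeta i => simp only [List.cons_append, keepOdd, ih, List.append_assoc]; split_ifs <;> simp
    | tau i => simp [keepOdd, ih]

theorem keepOdd_sublist (A w C : Word n) : (keepOdd f A w C).Sublist w := by
  induction w generalizing A with
  | nil => simp [keepOdd]
  | cons l w ih =>
    cases l with
    | zeta i =>
      simp only [keepOdd]
      split_ifs
      · exact (ih _).cons _
      · exact (ih _).cons_cons _
    | tau i => exact (ih _).cons_cons _

theorem keepOdd_congr (w : Word n) {A A' C C' : Word n}
    (h : ∀ (w₁ : Word n) (k : Fin (n - 1)) (w₂ : Word n), w = w₁ ++ zeta k :: w₂ →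
      f (A ++ w₁) k (w₂ ++ C) = f (A' ++ w₁) k (w₂ ++ C')) :
    keepOdd f A w C = keepOdd f A' w C' := by
  induction w generalizing A A' with
  | nil => simp [keepOdd]
  | cons l w ih =>
    have h' : keepOdd f (A ++ [l]) w C = keepOdd f (A' ++ [l]) w C' := by
      refine ih fun w₁ k w₂ hw => ?_
      simpa using h (l :: w₁) k w₂ (by simp [hw])
    cases l with
    | zeta i =>
      have h0 : f A i (w ++ C) = f A' i (w ++ C') := by simpa using h [] i w rfl
      simp only [keepOdd, h0, h']
    | tau i => simp only [keepOdd, h']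

theorem keepOdd_eq_self (w : Word n) {A C : Word n}
    (h : ∀ (w₁ : Word n) (k : Fin (n - 1)) (w₂ : Word n), w = w₁ ++ zeta k :: w₂ →
      f (A ++ w₁) k (w₂ ++ C) ≠ 0) :
    keepOdd f A w C = w := by
  induction w generalizing A with
  | nil => simp [keepOdd]
  | cons l w ih =>
    have h' : keepOdd f (A ++ [l]) w C = w := by
      refine ih fun w₁ k w₂ hw => ?_
      simpa using h (l :: w₁) k w₂ (by simp [hw])
    cases l with
    | zeta i =>
      have h0 : f A i (w ++ C) ≠ 0 := by simpa using h [] i w rfl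
      simp only [keepOdd, h0, h', if_false]
    | tau i => simp only [keepOdd, h']

variable {B : Set (FB n)} (p : Parity B)

/-- In every relation other than the third move, the parity axioms make the two sides either keep
the relation or lose crossings so that equal words remain. -/
theorem toF_keepOdd_of_rel {A u v C : Word n} (h : FBRel n u v) (hB : toFB (A ++ u ++ C) ∈ B) :
    toF (keepOdd p.val A u C) = toF (keepOdd p.val A v C) := by
  have key {u v : Word n} (h : StrongRel n u v) : toF u = toF v := toF_eq_of_rel (.strong h)
  rcases h with h | h
  · rcases h with h | i
    · cases h with
      | virtualSecond i => exact key (.virtualSecond i)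
      | virtualization i =>
        have := p.virtualization A C i hB
        simp only [keepOdd, List.nil_append, List.cons_append, this]
        split_ifs
        · rfl
        · exact key (.virtualization i)
      | farZetaZeta i j hij =>
        have h1 := p.farZetaZeta_left A C i j hij hB
        have h2 := p.farZetaZeta_right A C i j hij hB
        simp only [keepOdd, List.nil_append, List.cons_append, h1, h2]
        split_ifs
        · rfl
        · rfl
        · rfl
        · exact key (.farZetaZeta i j hij)
      | farZetaTau i j hij =>
        have h1 := p.farZetaTau A C i j hij hB
        simp only [keepOdd, List.nil_append, List.cons_append, h1]
        split_ifs
        · rfl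
        · exact key (.farZetaTau i j hij)
      | farTauTau i j hij => exact key (.farTauTau i j hij)
      | virtualThird i j hij => exact key (.virtualThird i j hij)
      | semivirtualThird i j hij =>
        have h1 := p.semivirtualThird A C i j hij hB
        simp only [keepOdd, List.nil_append, List.cons_append, List.append_assoc, h1]
        split_ifs
        · rfl
        · exact key (.semivirtualThird i j hij)
    · have h1 := p.classicalSecond A C i hB
      simp only [keepOdd, List.nil_append, List.cons_append, h1]
      split_ifs
      · rfl
      · exact toF_eq_of_rel (.classicalSecond i)
  · obtain ⟨i, j, hij⟩ := h
    have h0 := p.classicalThird_sum A C i j hij hB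
    have h1 := p.classicalThird_upper A C i j hij hB
    have h2 := p.classicalThird_middle A C i j hij hB
    have h3 := p.classicalThird_lower A C i j hij hB
    rw [h1, h2, h3] at h0
    simp only [keepOdd, List.nil_append, List.cons_append, List.append_assoc, h1, h2, h3]
    have sq (k : Fin (n - 1)) : toF [zeta k, zeta k] = toF [] :=
      toF_eq_of_rel (.classicalSecond k)
    generalize p.val (A ++ [zeta j, zeta i]) j C = x at *
    generalize p.val (A ++ [zeta j]) i (zeta j :: C) = y at *
    generalize p.val A j (zeta i :: zeta j :: C) = z at *
    -- The sum condition leaves zero or two odd crossings. If the outer two are odd, the sides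
    -- become `ζᵢ ζᵢ` and `ζⱼ ζⱼ`, both trivial; otherwise they become literally equal.
    have zo : ∀ x : ZMod 2, x = 0 ∨ x = 1 := by decide
    rcases zo x with rfl | rfl <;> rcases zo y with rfl | rfl <;> rcases zo z with rfl | rfl <;>
      first
        | exact absurd h0 (by decide)
        | simp [sq]

/-- The words which represent the same free braid and, inside any word for a braid of `B`, keep
doing so in `F n` after the deletion of the even crossings. -/
def keepOddCon : Con (FreeMonoid (Letter n)) where
  -- The first clause transports membership in `B`; the contexts `A`, `C` make the relation
  -- compatible with concatenation.
  r u v := toFB u.toList = toFB v.toList ∧ ∀ A C : Word n, toFB (A ++ u.toList ++ C) ∈ B →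
    toF (keepOdd p.val [] (A ++ u.toList ++ C) []) = toF (keepOdd p.val [] (A ++ v.toList ++ C) [])
  iseqv :=
    { refl := fun _ => ⟨rfl, fun _ _ _ => rfl⟩
      symm := fun h => ⟨h.1.symm, fun A C hB => (h.2 A C (by
        rw [toFB_append, toFB_append, h.1, ← toFB_append, ← toFB_append]; exact hB)).symm⟩
      trans := fun h h' => ⟨h.1.trans h'.1, fun A C hB => (h.2 A C hB).trans (h'.2 A C (by
        rw [toFB_append, toFB_append, ← h.1, ← toFB_append, ← toFB_append]; exact hB))⟩ }
  mul' := by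
    intro u u' v v' h h'
    refine ⟨by simp only [FreeMonoid.toList_mul, toFB_append, h.1, h'.1], fun A C hB => ?_⟩
    simp only [FreeMonoid.toList_mul] at hB ⊢
    have h1 := h.2 A (v.toList ++ C) (by simpa using hB)
    have h2 := h'.2 (A ++ u'.toList) C (by
      simp only [toFB_append, h.1] at hB ⊢
      simpa [mul_assoc] using hB)
    simp only [List.append_assoc] at h1 h2 ⊢
    exact h1.trans h2

theorem toF_keepOdd_eq {w w' : Word n} (h : toFB w = toFB w') (hB : toFB w ∈ B) :
    toF (keepOdd p.val [] w []) = toF (keepOdd p.val [] w' []) := by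
  have := (con_of_toFB_eq (keepOddCon p) (fun u v huv => ⟨toFB_eq_of_rel huv, fun A C hA => ?_⟩)
    h).2 [] [] (by simpa using hB)
  · simpa using this
  · simp only [FreeMonoid.toList_ofList] at hA ⊢
    have e1 : keepOdd p.val [] A (u ++ C) = keepOdd p.val [] A (v ++ C) := by
      refine keepOdd_congr _ _ fun w₁ k w₂ hw => ?_
      subst hw
      simpa using p.above w₁ k w₂ u v C huv hA
    have e2 : keepOdd p.val (A ++ u) C [] = keepOdd p.val (A ++ v) C [] := by
      refine keepOdd_congr _ _ fun w₁ k w₂ hw => ?_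
      subst hw
      simpa using p.below A u v w₁ k w₂ huv hA
    simp only [keepOdd_append, List.nil_append, List.append_nil, toF_append, e1, e2,
      toF_keepOdd_of_rel p huv hA]

end Keep

/-! ### Normal forms in right-angled Coxeter groups -/

section RightAngled

variable {α : Type*}

/-- Equivalence of lists generated by the exchange of neighbouring entries related by `I`. -/
inductive TraceEq (I : α → α → Prop) : List α → List α → Prop
  | nil : TraceEq I [] []
  | cons (x : α) {l l' : List α} (h : TraceEq I l l') : TraceEq I (x :: l) (x :: l')
  | swap (x y : α) (h : I x y) (l : List α) : TraceEq I (x :: y :: l) (y :: x :: l)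
  | trans {l₁ l₂ l₃ : List α} (h : TraceEq I l₁ l₂) (h' : TraceEq I l₂ l₃) : TraceEq I l₁ l₃

variable {I : α → α → Prop}

theorem TraceEq.refl (l : List α) : TraceEq I l l := by
  induction l with
  | nil => exact .nil
  | cons x l ih => exact .cons x ih

theorem TraceEq.symm (hI : ∀ x y, I x y → I y x) {l l' : List α} (h : TraceEq I l l') :
    TraceEq I l' l := by
  induction h with
  | nil => exact .nil
  | cons x _ ih => exact .cons x ih
  | swap x y h l => exact .swap y x (hI _ _ h) l
  | trans _ _ ih ih' => exact ih'.trans ih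

theorem TraceEq.prod_map {M : Type*} [Monoid M] (X : α → M)
    (hX : ∀ x y, I x y → X x * X y = X y * X x) {l l' : List α} (h : TraceEq I l l') :
    (l.map X).prod = (l'.map X).prod := by
  induction h with
  | nil => rfl
  | cons x _ ih => simp [ih]
  | swap x y h l => simp only [List.map_cons, List.prod_cons, ← mul_assoc, hX x y h]
  | trans _ _ ih ih' => exact ih.trans ih'

variable [DecidableEq α] (I) [DecidableRel I]

/-- Remove the first entry `x` of a list, if all entries before it are related to `x`. -/
def tryRemove (x : α) : List α → Option (List α)
  | [] => none
  | y :: l => if y = x then some l else if I y x then (tryRemove x l).map (y :: ·) else none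

/-- Left multiplication by the involution `x` on reduced lists. -/
def act (x : α) (l : List α) : List α := (tryRemove I x l).getD (x :: l)

/-- No two equal entries are separated by entries related to them only. -/
def Reduced : List α → Prop
  | [] => True
  | x :: l => tryRemove I x l = none ∧ Reduced l

variable {I}

theorem traceEq_of_tryRemove {x : α} (hI : ∀ x y, I x y → I y x) {l l' : List α}
    (h : tryRemove I x l = some l') :
    TraceEq I (x :: l') l := by
  induction l generalizing l' with
  | nil => simp [tryRemove] at h
  | cons y l ih =>
    rw [tryRemove] at h
    split_ifs at h with h1 h2
    · subst h1
      rw [Option.some.injEq] at h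
      subst h
      exact .refl _
    · obtain ⟨m, hm, rfl⟩ := Option.map_eq_some_iff.1 h
      exact (TraceEq.swap x y (hI _ _ h2) m).trans ((ih hm).cons y)

theorem exists_of_tryRemove_ne_none {x : α} {l : List α} (h : tryRemove I x l ≠ none) :
    ∃ l₁ l₂, l = l₁ ++ x :: l₂ ∧ ∀ y ∈ l₁, I y x := by
  induction l with
  | nil => simp [tryRemove] at h
  | cons y l ih =>
    rw [tryRemove] at h
    split_ifs at h with h1 h2
    · exact ⟨[], l, by simp [h1], by simp⟩
    · obtain ⟨l₁, l₂, rfl, h3⟩ := ih (by simpa using h)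
      exact ⟨y :: l₁, l₂, rfl, by simpa [h2] using h3⟩
    · exact absurd rfl h

/-- Because removal respects exchanges, both `act` and `Reduced` descend to lists up to exchanges.
-/
theorem TraceEq.tryRemove (hI : ∀ x y, I x y → I y x) (x : α) {l l' : List α}
    (h : TraceEq I l l') :
    Option.Rel (TraceEq I) (tryRemove I x l) (tryRemove I x l') := by
  induction h with
  | nil => exact .none
  | cons y h ih =>
    simp only [FreeBraid.tryRemove]
    revert ih
    generalize FreeBraid.tryRemove I x _ = a
    generalize FreeBraid.tryRemove I x _ = b
    intro ih
    split_ifs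
    · exact .some h
    · cases ih with
      | none => exact .none
      | some h => exact .some (h.cons y)
    · exact .none
  | swap y z h l =>
    -- `I` need not be irreflexive (the empty set is disjoint from itself); exchanging equal entries
    -- changes nothing.
    by_cases hyz : y = z
    · subst hyz
      cases FreeBraid.tryRemove I x (y :: y :: l) with
      | none => exact .none
      | some m => exact .some (.refl m)
    simp only [FreeBraid.tryRemove]
    by_cases hy : y = x
    · subst hy
      have hz : ¬ z = y := fun e => hyz e.symm
      simp only [if_true, if_neg hz, if_pos (hI _ _ h), Option.map_some]
      exact .some (.refl _)
    by_cases hz : z = x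
    · subst hz
      simp only [if_true, if_neg hy, if_pos h, Option.map_some]
      exact .some (.refl _)
    simp only [if_neg hy, if_neg hz]
    split_ifs
    · cases FreeBraid.tryRemove I x l with
      | none => exact .none
      | some m => exact .some (.swap y z h m)
    all_goals exact .none
  | trans h h' ih ih' =>
    revert ih ih'
    generalize FreeBraid.tryRemove I x _ = a
    generalize FreeBraid.tryRemove I x _ = b
    generalize FreeBraid.tryRemove I x _ = c
    rintro (⟨h1⟩ | _) (⟨h2⟩ | _)
    · exact .some (h1.trans h2)
    · exact .none

theorem TraceEq.tryRemove_eq_none (hI : ∀ x y, I x y → I y x) (x : α) {l l' : List α}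
    (h : TraceEq I l l') (hl : FreeBraid.tryRemove I x l = none) :
    FreeBraid.tryRemove I x l' = none := by
  have := h.tryRemove hI x
  rw [hl] at this
  generalize FreeBraid.tryRemove I x l' = a at this
  cases this
  rfl

theorem TraceEq.act (hI : ∀ x y, I x y → I y x) (x : α) {l l' : List α}
    (h : TraceEq I l l') : TraceEq I (act I x l) (act I x l') := by
  have := h.tryRemove hI x
  rw [FreeBraid.act, FreeBraid.act]
  revert this
  generalize FreeBraid.tryRemove I x l = a
  generalize FreeBraid.tryRemove I x l' = b
  rintro (⟨h1⟩ | _)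
  · exact h1
  · exact h.cons x

theorem TraceEq.reduced (hI : ∀ x y, I x y → I y x) {l l' : List α}
    (h : TraceEq I l l') (hl : Reduced I l) : Reduced I l' := by
  induction h with
  | nil => trivial
  | cons x h ih => exact ⟨h.tryRemove_eq_none hI x hl.1, ih hl.2⟩
  | swap x y h l =>
    obtain ⟨h1, h2, h3⟩ := hl
    rw [FreeBraid.tryRemove] at h1
    have hyx : ¬ y = x := fun e => by simp [e] at h1
    rw [if_neg hyx, if_pos (hI _ _ h)] at h1
    refine ⟨?_, by simpa using h1, h3⟩
    rw [FreeBraid.tryRemove, if_neg (fun e => hyx e.symm), h2]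
    simp
  | trans _ _ ih ih' => exact ih' (ih hl)

theorem Reduced.act (hI : ∀ x y, I x y → I y x) (x : α) {l : List α} (hl : Reduced I l) :
    Reduced I (act I x l) := by
  rw [FreeBraid.act]
  cases h : tryRemove I x l with
  | none => exact ⟨h, hl⟩
  | some m => exact ((traceEq_of_tryRemove hI h).symm hI |>.reduced hI hl).2

/-- If `x` can be removed from the reduced list `l`, leaving `m`, then `x :: m` is equivalent to
`l`, hence reduced. So `x` cannot be removed from `m` again and is put back in front. -/
theorem act_act (hI : ∀ x y, I x y → I y x) (x : α) {l : List α} (hl : Reduced I l) :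
    TraceEq I (act I x (act I x l)) l := by
  cases h : tryRemove I x l with
  | none => simp [act, h, tryRemove, TraceEq.refl]
  | some m =>
    have h1 := traceEq_of_tryRemove hI h
    simpa [act, h, ((h1.symm hI).reduced hI hl).1] using h1

theorem tryRemove_cons_of_rel {x y : α} (h : I y x) (hne : y ≠ x) (l : List α) :
    tryRemove I x (y :: l) = (tryRemove I x l).map (y :: ·) := by
  rw [tryRemove, if_neg hne, if_pos h]

theorem tryRemove_cons_self (x : α) (l : List α) : tryRemove I x (x :: l) = some l := by
  rw [tryRemove, if_pos rfl]

theorem TraceEq.exists_tryRemove (hI : ∀ x y, I x y → I y x) {x : α} {l l' m : List α}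
    (h : TraceEq I l l') (hl : FreeBraid.tryRemove I x l = some m) :
    ∃ m', FreeBraid.tryRemove I x l' = some m' ∧ TraceEq I m m' := by
  have := h.tryRemove hI x
  rw [hl] at this
  generalize FreeBraid.tryRemove I x l' = a at this
  cases this with
  | some h => exact ⟨_, rfl, h⟩

theorem act_comm (hI : ∀ x y, I x y → I y x) (x y : α) (hxy : I x y) (l : List α) :
    TraceEq I (act I x (act I y l)) (act I y (act I x l)) := by
  by_cases hne : x = y
  · subst hne; exact .refl _
  have hyx := hI _ _ hxy
  -- If only `x` can be removed, the two orders agree literally: an entry `x` related to `y` never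
  -- blocks `y`, so `y` is not removable from the remainder `m` either.
  have aux {x y : α} (hxy : I x y) (hne : x ≠ y) {m : List α} (hx : tryRemove I x l = some m)
      (hy : tryRemove I y l = none) :
      act I x (act I y l) = act I y (act I x l) := by
    have h1 := ((traceEq_of_tryRemove hI hx).symm hI).tryRemove_eq_none hI y hy
    rw [tryRemove_cons_of_rel hxy hne, Option.map_eq_none_iff] at h1
    have h2 : tryRemove I x (y :: l) = some (y :: m) := by
      rw [tryRemove_cons_of_rel (hI _ _ hxy) hne.symm, hx, Option.map_some]
    simp [act, hx, hy, h1, h2]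
  cases hx : tryRemove I x l with
  | none =>
    cases hy : tryRemove I y l with
    | none =>
      simp only [act, hx, hy, Option.getD_none, tryRemove_cons_of_rel hxy hne,
        tryRemove_cons_of_rel hyx (Ne.symm hne), Option.map_none]
      exact .swap x y hxy l
    | some k => rw [aux hyx (Ne.symm hne) hy hx]; exact .refl _
  | some m =>
    cases hy : tryRemove I y l with
    | none => rw [aux hxy hne hx hy]; exact .refl _
    | some k =>
      obtain ⟨k', h1, h2⟩ := ((traceEq_of_tryRemove hI hx).symm hI).exists_tryRemove hI hy
      rw [tryRemove_cons_of_rel hxy hne, Option.map_eq_some_iff] at h1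
      obtain ⟨m', h3, rfl⟩ := h1
      obtain ⟨k'', h4, h5⟩ := (h2.symm hI).exists_tryRemove hI (tryRemove_cons_self x m')
      simp only [act, hx, hy, h3, h4, Option.getD_some]
      exact h5.symm hI

/-- The normal form of a list, multiplied by a reduced list `l₀`. -/
def normalize (I : α → α → Prop) [DecidableRel I] (l l₀ : List α) : List α := l.foldr (act I) l₀

theorem normalize_append (l l' l₀ : List α) :
    normalize I (l ++ l') l₀ = normalize I l (normalize I l' l₀) := by
  simp [normalize]

theorem Reduced.normalize (hI : ∀ x y, I x y → I y x) (l : List α) {l₀ : List α}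
    (h : Reduced I l₀) : Reduced I (normalize I l l₀) := by
  induction l with
  | nil => exact h
  | cons x l ih => exact ih.act hI x

theorem TraceEq.normalize (hI : ∀ x y, I x y → I y x) (l : List α) {l₀ l₁ : List α}
    (h : TraceEq I l₀ l₁) : TraceEq I (normalize I l l₀) (normalize I l l₁) := by
  induction l with
  | nil => exact h
  | cons x l ih => exact ih.act hI x

/-- Together with the invariance of `normalize` up to exchanges, this gives uniqueness of reduced
forms. -/
theorem Reduced.normalize_nil {l : List α} (h : Reduced I l) : FreeBraid.normalize I l [] = l := by
  induction l with
  | nil => rfl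
  | cons x l ih =>
    have : FreeBraid.normalize I (x :: l) [] = FreeBraid.act I x (FreeBraid.normalize I l []) := rfl
    rw [this, ih h.2, FreeBraid.act, h.1, Option.getD_none]

theorem act_normalize_comm (hI : ∀ x y, I x y → I y x) (x : α) (l l₀ : List α)
    (h : ∀ y ∈ l, I y x) :
    TraceEq I (normalize I l (act I x l₀)) (act I x (normalize I l l₀)) := by
  induction l with
  | nil => exact .refl _
  | cons y l ih =>
    exact ((ih fun z hz => h z (by simp [hz])).act hI y).trans (act_comm hI y x (h y (by simp)) _)

/-- Deleting two equal entries separated by entries related to them does not change the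
normal form. -/
theorem normalize_delete (hI : ∀ x y, I x y → I y x) (x : α) (l₁ l₂ l₃ : List α) {l₀ : List α}
    (h₀ : Reduced I l₀) (h : ∀ y ∈ l₂, I y x) :
    TraceEq I (normalize I (l₁ ++ x :: (l₂ ++ x :: l₃)) l₀)
      (normalize I (l₁ ++ (l₂ ++ l₃)) l₀) := by
  simp only [normalize_append]
  refine TraceEq.normalize hI l₁ ?_
  have e (l : List α) (m) : normalize I (x :: l) m = act I x (normalize I l m) := rfl
  rw [e, normalize_append, e]
  exact ((act_normalize_comm hI x l₂ _ h).act hI x).trans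
    (act_act hI x ((h₀.normalize hI l₃).normalize hI l₂))

/-- A list which is not reduced has two equal entries separated by entries related to them. -/
theorem exists_of_not_reduced (l : List α) (h : ¬ Reduced I l) :
    ∃ x l₁ l₂ l₃, l = l₁ ++ x :: (l₂ ++ x :: l₃) ∧ ∀ y ∈ l₂, I y x := by
  induction l with
  | nil => exact absurd trivial h
  | cons x l ih =>
    by_cases hx : tryRemove I x l = none
    · obtain ⟨y, l₁, l₂, l₃, rfl, h'⟩ := ih fun hl => h ⟨hx, hl⟩
      exact ⟨y, x :: l₁, l₂, l₃, rfl, h'⟩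
    · obtain ⟨l₁, l₂, rfl, h'⟩ := exists_of_tryRemove_ne_none hx
      exact ⟨x, [], l₁, l₂, rfl, h'⟩

end RightAngled

/-! ### The list of crossings as an invariant of `F n` -/

section Crossings

variable {n : ℕ}

/-- The transposition of the positions exchanged by the `i`-th generators. -/
def adjSwap (i : Fin (n - 1)) : Equiv.Perm (Fin n) := Equiv.swap (leftPos i) (rightPos i)

/-- The strands at the positions exchanged by the `i`-th generators, if the strand at position `k`
is `σ k`. -/
def pairAt (σ : Equiv.Perm (Fin n)) (i : Fin (n - 1)) : Finset (Fin n) :=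
  {σ (leftPos i), σ (rightPos i)}

theorem leftPos_ne_rightPos (i : Fin (n - 1)) : leftPos i ≠ rightPos i := by
  simp [leftPos, rightPos, Fin.ext_iff]

theorem Next.rightPos_eq {i j : Fin (n - 1)} (h : Next i j) : rightPos i = leftPos j :=
  Fin.ext h

theorem Next.leftPos_ne_rightPos {i j : Fin (n - 1)} (h : Next i j) :
    leftPos i ≠ rightPos j := by
  have : (i : ℕ) + 1 = j := h
  simp [leftPos, rightPos, Fin.ext_iff]
  omega

theorem Far.symm {i j : Fin (n - 1)} (h : Far i j) : Far j i := Or.symm h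

theorem Far.ne {i j : Fin (n - 1)} (h : Far i j) :
    leftPos i ≠ leftPos j ∧ leftPos i ≠ rightPos j ∧ rightPos i ≠ leftPos j ∧
      rightPos i ≠ rightPos j := by
  have : (i : ℕ) + 2 ≤ (j : ℕ) ∨ (j : ℕ) + 2 ≤ (i : ℕ) := h
  simp only [leftPos, rightPos, ne_eq, Fin.ext_iff]
  omega

theorem adjSwap_left (i : Fin (n - 1)) : adjSwap i (leftPos i) = rightPos i :=
  Equiv.swap_apply_left _ _

theorem adjSwap_right (i : Fin (n - 1)) : adjSwap i (rightPos i) = leftPos i :=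
  Equiv.swap_apply_right _ _

theorem Far.adjSwap_left {i j : Fin (n - 1)} (h : Far i j) :
    adjSwap i (leftPos j) = leftPos j :=
  Equiv.swap_apply_of_ne_of_ne h.ne.1.symm h.ne.2.2.1.symm

theorem Far.adjSwap_right {i j : Fin (n - 1)} (h : Far i j) :
    adjSwap i (rightPos j) = rightPos j :=
  Equiv.swap_apply_of_ne_of_ne h.ne.2.1.symm h.ne.2.2.2.symm

theorem Next.adjSwap_fst_right {i j : Fin (n - 1)} (h : Next i j) :
    adjSwap i (rightPos j) = rightPos j :=
  Equiv.swap_apply_of_ne_of_ne h.leftPos_ne_rightPos.symm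
    (by rw [h.rightPos_eq]; exact (FreeBraid.leftPos_ne_rightPos j).symm)

theorem Next.adjSwap_snd_left {i j : Fin (n - 1)} (h : Next i j) :
    adjSwap j (leftPos i) = leftPos i :=
  Equiv.swap_apply_of_ne_of_ne (by rw [← h.rightPos_eq]; exact FreeBraid.leftPos_ne_rightPos i)
    h.leftPos_ne_rightPos

theorem adjSwap_mul_self (i : Fin (n - 1)) : adjSwap i * adjSwap i = 1 :=
  Equiv.swap_mul_self _ _

theorem Far.adjSwap_comm {i j : Fin (n - 1)} (h : Far i j) :
    adjSwap i * adjSwap j = adjSwap j * adjSwap i := by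
  have := Equiv.Perm.Disjoint.commute (f := adjSwap i) (g := adjSwap j) (fun k => by
    by_cases h1 : k = leftPos i
    · subst h1; exact .inr h.symm.adjSwap_left
    by_cases h2 : k = rightPos i
    · subst h2; exact .inr h.symm.adjSwap_right
    exact .inl (Equiv.swap_apply_of_ne_of_ne h1 h2))
  exact this

theorem Next.adjSwap_braid {i j : Fin (n - 1)} (h : Next i j) :
    adjSwap i * adjSwap j * adjSwap i = adjSwap j * adjSwap i * adjSwap j := by
  have h1 := FreeBraid.leftPos_ne_rightPos i
  have h2 := FreeBraid.leftPos_ne_rightPos j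
  have h3 := h.leftPos_ne_rightPos
  simp only [adjSwap]
  rw [← h.rightPos_eq] at h2 ⊢
  have e := Equiv.swap_mul_swap_mul_swap h2.symm h3.symm
  rw [Equiv.swap_comm (rightPos i), Equiv.swap_comm (rightPos j)] at e
  rw [e, Equiv.swap_mul_swap_mul_swap h1 h3, Equiv.swap_comm]

theorem swap_zeta (i : Fin (n - 1)) : (zeta i).swap = adjSwap i := rfl

theorem swap_tau (i : Fin (n - 1)) : (tau i).swap = adjSwap i := rfl

theorem strandAt_nil : strandAt ([] : Word n) = 1 := rfl

theorem strandAt_cons (l : Letter n) (w : Word n) : strandAt (l :: w) = l.swap * strandAt w := by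
  simp [strandAt]

theorem strandAt_append (u v : Word n) : strandAt (u ++ v) = strandAt u * strandAt v := by
  simp [strandAt]

theorem pairAt_mul_self (σ : Equiv.Perm (Fin n)) (i : Fin (n - 1)) :
    pairAt (σ * adjSwap i) i = pairAt σ i := by
  simp [pairAt, adjSwap_left, adjSwap_right, Finset.pair_comm]

theorem Far.pairAt_mul {i j : Fin (n - 1)} (h : Far i j) (σ : Equiv.Perm (Fin n)) :
    pairAt (σ * adjSwap i) j = pairAt σ j := by
  simp [pairAt, h.adjSwap_left, h.adjSwap_right]

theorem Next.pairAt_mul_mul {i j : Fin (n - 1)} (h : Next i j) (σ : Equiv.Perm (Fin n)) :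
    pairAt (σ * adjSwap i * adjSwap j) i = pairAt σ j := by
  simp only [pairAt, Equiv.Perm.mul_apply, h.adjSwap_snd_left, FreeBraid.adjSwap_left]
  rw [h.rightPos_eq, FreeBraid.adjSwap_left, h.adjSwap_fst_right]

theorem Far.disjoint_pairAt {i j : Fin (n - 1)} (h : Far i j) (σ : Equiv.Perm (Fin n)) :
    Disjoint (pairAt σ i) (pairAt σ j) := by
  obtain ⟨h1, h2, h3, h4⟩ := h.ne
  simp [pairAt, h1.symm, h2.symm, h3.symm, h4.symm]

/-- The pairs of strands which meet in the classical crossings of a word, if the strand at the upper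
position `k` is `σ k`. -/
def crossings : Equiv.Perm (Fin n) → Word n → List (Finset (Fin n))
  | _, [] => []
  | σ, zeta i :: w => pairAt σ i :: crossings (σ * adjSwap i) w
  | σ, tau i :: w => crossings (σ * adjSwap i) w

theorem crossings_append (σ : Equiv.Perm (Fin n)) (u v : Word n) :
    crossings σ (u ++ v) = crossings σ u ++ crossings (σ * strandAt u) v := by
  induction u generalizing σ with
  | nil => simp [crossings, strandAt_nil]
  | cons l u ih =>
    cases l <;> simp [crossings, ih, strandAt_cons, mul_assoc, swap_tau,
      swap_zeta]

theorem exists_of_crossings_eq {σ : Equiv.Perm (Fin n)} {w : Word n} {x : Finset (Fin n)}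
    {l₁ l₂ : List (Finset (Fin n))} (h : crossings σ w = l₁ ++ x :: l₂) :
    ∃ (A : Word n) (i : Fin (n - 1)) (C : Word n), w = A ++ zeta i :: C ∧ crossings σ A = l₁ ∧
      pairAt (σ * strandAt A) i = x ∧ crossings (σ * strandAt (A ++ [zeta i])) C = l₂ := by
  induction w generalizing σ l₁ with
  | nil => simp [crossings] at h
  | cons l w ih =>
    cases l with
    | zeta i =>
      rw [crossings] at h
      cases l₁ with
      | nil =>
        rw [List.nil_append, List.cons.injEq] at h
        exact ⟨[], i, w, rfl, rfl, by simpa [strandAt_nil] using h.1,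
          by simpa [strandAt_cons, strandAt_nil, swap_zeta] using h.2⟩
      | cons y l₁ =>
        rw [List.cons_append, List.cons.injEq] at h
        obtain ⟨A, j, C, rfl, h1, h2, h3⟩ := ih h.2
        exact ⟨zeta i :: A, j, C, rfl, by rw [crossings, h.1, h1],
          by rw [← h2, strandAt_cons, mul_assoc]; rfl,
          by rw [← h3, List.cons_append, strandAt_cons, mul_assoc]; rfl⟩
    | tau i =>
      rw [crossings] at h
      obtain ⟨A, j, C, rfl, h1, h2, h3⟩ := ih h
      exact ⟨tau i :: A, j, C, rfl, by rw [crossings, h1],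
        by rw [← h2, strandAt_cons, mul_assoc]; rfl,
        by rw [← h3, List.cons_append, strandAt_cons, mul_assoc]; rfl⟩

theorem pairAt_mem_crossings (σ : Equiv.Perm (Fin n)) (A : Word n) (i : Fin (n - 1)) (C : Word n) :
    pairAt (σ * strandAt A) i ∈ crossings σ (A ++ zeta i :: C) := by
  simp [crossings_append, crossings]

theorem disjoint_finset_symm (s t : Finset (Fin n)) (h : Disjoint s t) : Disjoint t s := h.symm

/-- The crossings of an irreducible word form a reduced list. -/
theorem IsIrreducible.reduced {w : Word n} (h : IsIrreducible w) :
    Reduced Disjoint (crossings 1 w) := by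
  by_contra hw
  obtain ⟨x, l₁, l₂, l₃, hl, hx⟩ := exists_of_not_reduced _ hw
  obtain ⟨A, i, D, rfl, -, rfl, h1⟩ := exists_of_crossings_eq hl
  obtain ⟨M, j, C, rfl, rfl, h2, -⟩ := exists_of_crossings_eq h1
  refine h _ ⟨A, i, M, j, C, rfl, rfl, ?_, ?_⟩
  · rw [one_mul, one_mul, ← strandAt_append] at h2
    simpa [strands, pairAt] using h2
  · rintro M₁ k M₂ rfl
    have := hx _ (pairAt_mem_crossings _ M₁ k M₂)
    rw [one_mul, one_mul, ← strandAt_append] at this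
    simpa [strands, pairAt] using this

/-- The words which permute the positions in the same way and whose crossings have equivalent
normal forms. -/
def crossingCon (n : ℕ) : Con (FreeMonoid (Letter n)) where
  -- The quantifiers make this a congruence: a prefix changes the labelling `σ`, a suffix changes
  -- the list `l₀` acted on.
  r u v := strandAt u.toList = strandAt v.toList ∧ ∀ σ l₀, Reduced Disjoint l₀ →
    TraceEq Disjoint (normalize Disjoint (crossings σ u.toList) l₀)
      (normalize Disjoint (crossings σ v.toList) l₀)
  iseqv :=
    { refl := fun _ => ⟨rfl, fun _ _ _ => .refl _⟩
      symm := fun h => ⟨h.1.symm, fun σ l₀ h₀ => (h.2 σ l₀ h₀).symm disjoint_finset_symm⟩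
      trans := fun h h' => ⟨h.1.trans h'.1, fun σ l₀ h₀ => (h.2 σ l₀ h₀).trans (h'.2 σ l₀ h₀)⟩ }
  mul' := by
    intro u u' v v' h h'
    refine ⟨by simp only [FreeMonoid.toList_mul, strandAt_append, h.1, h'.1], fun σ l₀ h₀ => ?_⟩
    simp only [FreeMonoid.toList_mul, crossings_append, normalize_append, h.1]
    exact (h.2 _ _ (h₀.normalize disjoint_finset_symm _)).trans
      ((h'.2 _ _ h₀).normalize disjoint_finset_symm _)

theorem crossingCon_of_eq {u v : Word n} (h : strandAt u = strandAt v)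
    (h' : ∀ σ, crossings σ u = crossings σ v) :
    crossingCon n (FreeMonoid.ofList u) (FreeMonoid.ofList v) :=
  ⟨h, fun σ _ _ => by simp only [FreeMonoid.toList_ofList, h' σ]; exact .refl _⟩

theorem crossingCon_of_rel {u v : Word n} (h : FRel n u v) :
    crossingCon n (FreeMonoid.ofList u) (FreeMonoid.ofList v) := by
  rcases h with h | i
  · cases h with
    | virtualSecond i =>
      exact crossingCon_of_eq (by simp [strandAt, swap_tau, adjSwap_mul_self])
        fun σ => rfl
    | virtualization i =>
      exact crossingCon_of_eq rfl fun σ => by simp [crossings, pairAt_mul_self]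
    | farZetaZeta i j h =>
      refine ⟨by simpa [strandAt, swap_zeta, swap_tau] using h.adjSwap_comm, fun σ l₀ _ => ?_⟩
      simp only [FreeMonoid.toList_ofList, crossings, h.pairAt_mul, h.symm.pairAt_mul]
      exact act_comm disjoint_finset_symm _ _ (h.disjoint_pairAt σ) _
    | farZetaTau i j h =>
      exact crossingCon_of_eq (by simpa [strandAt, swap_zeta, swap_tau] using h.adjSwap_comm)
        fun σ => by simp [crossings, h.symm.pairAt_mul]
    | farTauTau i j h =>
      exact crossingCon_of_eq (by simpa [strandAt, swap_zeta, swap_tau] using h.adjSwap_comm)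
        fun σ => rfl
    | virtualThird i j h =>
      exact crossingCon_of_eq
        (by simpa [strandAt, swap_zeta, swap_tau, mul_assoc] using h.adjSwap_braid)
        fun σ => rfl
    | semivirtualThird i j h =>
      exact crossingCon_of_eq
        (by simpa [strandAt, swap_zeta, swap_tau, mul_assoc] using h.adjSwap_braid)
        fun σ => by simp [crossings, h.pairAt_mul_mul]
  · refine ⟨by simp [strandAt, swap_zeta, adjSwap_mul_self], fun σ l₀ h₀ => ?_⟩
    simp only [FreeMonoid.toList_ofList, crossings, pairAt_mul_self]
    exact act_act disjoint_finset_symm _ h₀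

/-- The transposition exchanges the names of two strands that lie on no classical crossing of `w`;
virtual crossings may involve them but are not recorded. -/
theorem crossings_swap_mul {a b : Fin n} {σ : Equiv.Perm (Fin n)} {w : Word n}
    (h : ∀ s ∈ crossings σ w, Disjoint s {a, b}) :
    crossings (Equiv.swap a b * σ) w = crossings σ w := by
  induction w generalizing σ with
  | nil => rfl
  | cons l w ih =>
    cases l with
    | zeta i =>
      simp only [crossings, List.mem_cons, forall_eq_or_imp] at h ⊢
      rw [mul_assoc, ih h.2]
      congr 1
      have h1 := h.1
      simp only [pairAt, Finset.disjoint_insert_left, Finset.disjoint_singleton_left,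
        Finset.mem_insert, Finset.mem_singleton, not_or] at h1
      simp only [pairAt, Equiv.Perm.mul_apply]
      rw [Equiv.swap_apply_of_ne_of_ne h1.1.1 h1.1.2, Equiv.swap_apply_of_ne_of_ne h1.2.1 h1.2.2]
    | tau i =>
      simp only [crossings] at h ⊢
      rw [mul_assoc, ih h]

theorem mul_adjSwap (σ : Equiv.Perm (Fin n)) (i : Fin (n - 1)) :
    σ * adjSwap i = Equiv.swap (σ (leftPos i)) (σ (rightPos i)) * σ := by
  rw [adjSwap, Equiv.mul_swap_eq_swap_mul]

theorem swap_eq_of_pair_eq {a b c d : Fin n} (h : ({a, b} : Finset (Fin n)) = {c, d}) :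
    Equiv.swap a b = Equiv.swap c d := by
  have h' : ({a, b} : Set (Fin n)) = {c, d} := by
    simpa using congrArg (fun s : Finset (Fin n) => (s : Set (Fin n))) h
  rcases Set.pair_eq_pair_iff.1 h' with ⟨rfl, rfl⟩ | ⟨rfl, rfl⟩
  · rfl
  · exact Equiv.swap_comm _ _

theorem pairAt_mul (σ ρ : Equiv.Perm (Fin n)) (i : Fin (n - 1)) :
    pairAt (σ * ρ) i = (pairAt ρ i).map σ.toEmbedding := by
  simp [pairAt]

theorem crossings_mul (σ ρ : Equiv.Perm (Fin n)) (w : Word n) :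
    crossings (σ * ρ) w = (crossings ρ w).map (Finset.map σ.toEmbedding) := by
  induction w generalizing ρ with
  | nil => rfl
  | cons l w ih => cases l <;> simp only [crossings, mul_assoc, ih, pairAt_mul, List.map_cons]

/-- Deleting the first crossing only exchanges the names of its two strands until the second one. No
classical crossing in between lies on them, and deleting the second crossing restores the names. So
the list loses just two equal entries separated by disjoint ones. -/
theorem crossingCon_of_bigonReduction {w w' : Word n} (h : BigonReduction w w') :
    crossingCon n (FreeMonoid.ofList w) (FreeMonoid.ofList w') := by
  obtain ⟨A, i, M, j, C, rfl, rfl, hs, hM⟩ := h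
  -- The bigon condition is stated for the labelling `strandAt A`; renaming the strands transfers it
  -- to every `σ`, here and in `hM'`.
  have hs' (σ : Equiv.Perm (Fin n)) :
      pairAt (σ * adjSwap i * strandAt M) j = pairAt σ i := by
    have e : pairAt (strandAt A * (adjSwap i * strandAt M)) j = pairAt (strandAt A * 1) i := by
      rw [mul_one, ← mul_assoc]
      simpa [strands, pairAt, strandAt_append, strandAt_cons, swap_zeta, mul_assoc] using hs
    rw [pairAt_mul, pairAt_mul _ 1, Finset.map_inj] at e
    rw [mul_assoc, pairAt_mul, e, ← pairAt_mul, mul_one]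
  have hM' (σ : Equiv.Perm (Fin n)) :
      ∀ s ∈ crossings (σ * adjSwap i) M, Disjoint s (pairAt σ i) := by
    intro s hs
    rw [crossings_mul] at hs
    obtain ⟨t, ht, rfl⟩ := List.mem_map.1 hs
    rw [← mul_one σ, pairAt_mul, mul_one, Finset.disjoint_map]
    obtain ⟨l₁, l₂, hl⟩ := List.append_of_mem ht
    obtain ⟨M₁, k, M₂, rfl, -, rfl, -⟩ := exists_of_crossings_eq hl
    rw [← Finset.disjoint_map (strandAt A).toEmbedding, ← pairAt_mul, ← pairAt_mul, mul_one]
    simpa [strands, pairAt, strandAt_append, strandAt_cons, swap_zeta] using hM M₁ k M₂ rfl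
  have e1 (σ : Equiv.Perm (Fin n)) :
      σ * adjSwap i * strandAt M * adjSwap j = σ * strandAt M := by
    rw [mul_adjSwap, swap_eq_of_pair_eq (hs' σ), ← mul_assoc, ← mul_assoc, ← mul_adjSwap,
      mul_assoc σ, adjSwap_mul_self, mul_one]
  have e2 (σ : Equiv.Perm (Fin n)) : crossings (σ * adjSwap i) M = crossings σ M := by
    have := crossings_swap_mul (hM' σ)
    rwa [mul_adjSwap, ← mul_assoc, Equiv.swap_mul_self, one_mul, ← mul_adjSwap, eq_comm] at this
  refine ⟨?_, fun σ l₀ h₀ => ?_⟩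
  · have := e1 1
    simp only [one_mul] at this
    simp only [FreeMonoid.toList_ofList, strandAt_append, strandAt_cons, swap_zeta]
    rw [← mul_assoc (strandAt M), ← mul_assoc (adjSwap i), ← mul_assoc (adjSwap i), this]
  · simp only [FreeMonoid.toList_ofList, crossings_append, crossings, hs', e1]
    rw [← e2 (σ * strandAt A)]
    exact normalize_delete disjoint_finset_symm _ _ _ _ h₀ (hM' _)

theorem BigonReduction.sublist {w w' : Word n} (h : BigonReduction w w') : w'.Sublist w := by
  obtain ⟨A, i, M, j, C, rfl, rfl, -, -⟩ := h
  simp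

theorem BigonReduction.length_lt {w w' : Word n} (h : BigonReduction w w') :
    w'.length < w.length := by
  obtain ⟨A, i, M, j, C, rfl, rfl, -, -⟩ := h
  simp

/-- Every word can be made irreducible by bigon reductions. -/
theorem exists_irreducible (w : Word n) : ∃ γ : Word n, γ.Sublist w ∧ IsIrreducible γ ∧
    crossingCon n (FreeMonoid.ofList w) (FreeMonoid.ofList γ) := by
  by_cases h : IsIrreducible w
  · exact ⟨w, .refl w, h, (crossingCon n).refl _⟩
  · obtain ⟨w', h⟩ := not_forall_not.1 h
    obtain ⟨γ, h1, h2, h3⟩ := exists_irreducible w'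
    exact ⟨γ, h1.trans h.sublist, h2, (crossingCon n).trans (crossingCon_of_bigonReduction h) h3⟩
termination_by w.length
decreasing_by exact h.length_lt

end Crossings

/-! ### Descents of permutations -/

section Descents

variable {n : ℕ}

theorem eq_or_far_or_next (i j : Fin (n - 1)) : i = j ∨ Far i j ∨ Next i j ∨ Next j i := by
  have h1 : Far i j ↔ (i : ℕ) + 2 ≤ (j : ℕ) ∨ (j : ℕ) + 2 ≤ (i : ℕ) := Iff.rfl
  have h2 : Next i j ↔ (i : ℕ) + 1 = j := Iff.rfl
  have h3 : Next j i ↔ (j : ℕ) + 1 = i := Iff.rfl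
  rw [h1, h2, h3, Fin.ext_iff]
  omega

/-- `σ` is decreasing at the positions exchanged by the `i`-th generators. -/
def Descent (σ : Equiv.Perm (Fin n)) (i : Fin (n - 1)) : Prop := σ (rightPos i) < σ (leftPos i)

/-- A quantity which decreases when a descent is removed. -/
def weight (σ : Equiv.Perm (Fin n)) : ℕ := ∑ k : Fin n, (k : ℕ) * (n - σ k)

/-- Only two summands change, and in `ℤ` the total difference is `σ (rightPos i) - σ (leftPos i)`.
-/
theorem weight_lt {σ : Equiv.Perm (Fin n)} {i : Fin (n - 1)} (h : Descent σ i) :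
    weight (σ * adjSwap i) < weight σ := by
  have cast (ρ : Equiv.Perm (Fin n)) :
      (weight ρ : ℤ) = ∑ k : Fin n, (k : ℤ) * ((n : ℤ) - (ρ k : ℕ)) := by
    rw [weight, Nat.cast_sum]
    refine Finset.sum_congr rfl fun k _ => ?_
    rw [Nat.cast_mul, Nat.cast_sub (ρ k).2.le]
  have hs (k : Fin n) : adjSwap i (adjSwap i k) = k := by
    rw [← Equiv.Perm.mul_apply, adjSwap_mul_self, Equiv.Perm.one_apply]
  have e : (weight (σ * adjSwap i) : ℤ) =
      ∑ k : Fin n, ((adjSwap i k : ℕ) : ℤ) * ((n : ℤ) - (σ k : ℕ)) := by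
    rw [cast, ← Equiv.sum_comp (adjSwap i)]
    simp only [Equiv.Perm.mul_apply, hs]
  have d : (weight (σ * adjSwap i) : ℤ) - weight σ =
      (σ (rightPos i) : ℕ) - (σ (leftPos i) : ℕ) := by
    rw [e, cast, ← Finset.sum_sub_distrib,
      Fintype.sum_eq_add _ _ (leftPos_ne_rightPos i) (fun k hk => by
        rw [adjSwap, Equiv.swap_apply_of_ne_of_ne hk.1 hk.2, sub_self]),
      adjSwap_left, adjSwap_right]
    simp only [leftPos, rightPos]
    push_cast
    ring
  have h' : (σ (rightPos i) : ℕ) < σ (leftPos i) := h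
  omega

theorem descent_mul_adjSwap {σ : Equiv.Perm (Fin n)} {i : Fin (n - 1)} (h : ¬ Descent σ i) :
    Descent (σ * adjSwap i) i := by
  have h1 : σ (leftPos i) ≠ σ (rightPos i) := σ.injective.ne (leftPos_ne_rightPos i)
  rw [Descent, not_lt] at h
  rw [Descent, Equiv.Perm.mul_apply, Equiv.Perm.mul_apply, adjSwap_left, adjSwap_right]
  exact lt_of_le_of_ne h h1

theorem not_descent_one (i : Fin (n - 1)) : ¬ Descent 1 i := by
  simp [Descent, leftPos, rightPos]

theorem eq_one_of_not_descent {σ : Equiv.Perm (Fin n)} (h : ∀ i, ¬ Descent σ i) : σ = 1 := by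
  cases n with
  | zero => exact Subsingleton.elim _ _
  | succ m =>
    have hm : StrictMono σ := Fin.strictMono_iff_lt_succ.2 fun i => by
      have := descent_mul_adjSwap (h i)
      rw [Descent, Equiv.Perm.mul_apply, Equiv.Perm.mul_apply, adjSwap_left, adjSwap_right] at this
      exact this
    have := Subsingleton.elim (hm.orderIsoOfSurjective σ σ.surjective) (OrderIso.refl _)
    ext k
    exact congrArg (fun f : Fin (m + 1) ≃o Fin (m + 1) => (f k : ℕ)) this

theorem Far.descent_mul {i j : Fin (n - 1)} (h : Far i j) {σ : Equiv.Perm (Fin n)}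
    (hj : Descent σ j) : Descent (σ * adjSwap i) j := by
  simpa [Descent, h.adjSwap_left, h.adjSwap_right] using hj

theorem Next.descent_mul_fst_iff {i j : Fin (n - 1)} (h : Next i j) (σ : Equiv.Perm (Fin n)) :
    Descent (σ * adjSwap i) j ↔ σ (rightPos j) < σ (leftPos i) := by
  rw [Descent, Equiv.Perm.mul_apply, Equiv.Perm.mul_apply, h.adjSwap_fst_right, ← h.rightPos_eq,
    FreeBraid.adjSwap_right]

theorem Next.descent_mul_snd_iff {i j : Fin (n - 1)} (h : Next i j) (σ : Equiv.Perm (Fin n)) :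
    Descent (σ * adjSwap j) i ↔ σ (rightPos j) < σ (leftPos i) := by
  rw [Descent, Equiv.Perm.mul_apply, Equiv.Perm.mul_apply, h.adjSwap_snd_left, h.rightPos_eq,
    FreeBraid.adjSwap_left]

theorem Next.descent_mul_mul_fst_iff {i j : Fin (n - 1)} (h : Next i j) (σ : Equiv.Perm (Fin n)) :
    Descent (σ * adjSwap i * adjSwap j) i ↔ Descent σ j := by
  rw [h.descent_mul_snd_iff, Equiv.Perm.mul_apply, Equiv.Perm.mul_apply, h.adjSwap_fst_right,
    FreeBraid.adjSwap_left, h.rightPos_eq, Descent]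

theorem Next.descent_mul_mul_snd_iff {i j : Fin (n - 1)} (h : Next i j) (σ : Equiv.Perm (Fin n)) :
    Descent (σ * adjSwap j * adjSwap i) j ↔ Descent σ i := by
  rw [h.descent_mul_fst_iff, Equiv.Perm.mul_apply, Equiv.Perm.mul_apply, h.adjSwap_snd_left,
    FreeBraid.adjSwap_right, ← h.rightPos_eq, Descent]

theorem mul_adjSwap_mul_adjSwap (σ : Equiv.Perm (Fin n)) (i : Fin (n - 1)) :
    σ * adjSwap i * adjSwap i = σ := by
  rw [mul_assoc, adjSwap_mul_self, mul_one]

end Descents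

/-! ### Lifting permutations to a monoid -/

section PermElem

variable {n : ℕ} {M : Type*} [Monoid M] (T : Fin (n - 1) → M)

open Classical in
/-- The product of the elements `T i` along a reduced decomposition of `σ`. -/
noncomputable def permElem (σ : Equiv.Perm (Fin n)) : M :=
  if h : ∃ i, Descent σ i then permElem (σ * adjSwap h.choose) * T h.choose else 1
termination_by weight σ
decreasing_by exact weight_lt h.choose_spec

theorem permElem_one : permElem T 1 = 1 := by
  rw [permElem, dif_neg (fun h => not_descent_one _ h.choose_spec)]

variable {T} (hsq : ∀ i, T i * T i = 1) (hfar : ∀ i j, Far i j → T i * T j = T j * T i)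
  (hnext : ∀ i j, Next i j → T i * T j * T i = T j * T i * T j)

include hfar hnext in
-- Independence of the chosen descent, by induction on the weight: two different descents lead to a
-- common smaller permutation, and the two paths agree by commutation or the braid relation.
theorem permElem_of_descent {σ : Equiv.Perm (Fin n)} {i : Fin (n - 1)} (h : Descent σ i) :
    permElem T σ = permElem T (σ * adjSwap i) * T i := by
  have far {i j : Fin (n - 1)} (hij : Far i j) (hi : Descent σ i) (hj : Descent σ j) :
      permElem T (σ * adjSwap i) * T i = permElem T (σ * adjSwap j) * T j := by
    have := weight_lt hi
    have := weight_lt hj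
    rw [permElem_of_descent (hij.descent_mul hj), permElem_of_descent (hij.symm.descent_mul hi),
      mul_assoc, mul_assoc, mul_assoc, mul_assoc, hij.adjSwap_comm, hfar i j hij]
  have next {i j : Fin (n - 1)} (hij : Next i j) (hi : Descent σ i) (hj : Descent σ j) :
      permElem T (σ * adjSwap i) * T i = permElem T (σ * adjSwap j) * T j := by
    -- Two neighbouring descents reverse all three values, so a whole braid triple can be split off.
    have hca : σ (rightPos j) < σ (leftPos i) := by
      rw [Descent, ← hij.rightPos_eq] at hj
      exact hj.trans hi
    have := weight_lt hi
    have := weight_lt hj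
    have d1 := (hij.descent_mul_fst_iff σ).2 hca
    have d2 := (hij.descent_mul_snd_iff σ).2 hca
    have := weight_lt d1
    have := weight_lt d2
    rw [permElem_of_descent d1, permElem_of_descent d2,
      permElem_of_descent ((hij.descent_mul_mul_fst_iff σ).2 hj),
      permElem_of_descent ((hij.descent_mul_mul_snd_iff σ).2 hi)]
    have e := hij.adjSwap_braid
    have e' := hnext i j hij
    simp only [mul_assoc] at e e' ⊢
    rw [e, e']
  have hex : ∃ i, Descent σ i := ⟨i, h⟩
  rw [permElem, dif_pos hex]
  have h' := hex.choose_spec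
  generalize hex.choose = j at h' ⊢
  rcases eq_or_far_or_next i j with rfl | hij | hij | hij
  · rfl
  · exact (far hij h h').symm
  · exact (next hij h h').symm
  · exact next hij h' h
termination_by weight σ

include hsq hfar hnext

theorem permElem_mul_adjSwap (σ : Equiv.Perm (Fin n)) (i : Fin (n - 1)) :
    permElem T (σ * adjSwap i) = permElem T σ * T i := by
  by_cases h : Descent σ i
  · rw [permElem_of_descent hfar hnext h, mul_assoc, hsq, mul_one]
  · rw [permElem_of_descent hfar hnext (descent_mul_adjSwap h), mul_adjSwap_mul_adjSwap]

theorem permElem_mul (σ ρ : Equiv.Perm (Fin n)) :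
    permElem T (σ * ρ) = permElem T σ * permElem T ρ := by
  by_cases h : ∃ i, Descent ρ i
  · obtain ⟨i, h⟩ := h
    have := weight_lt h
    rw [permElem_of_descent hfar hnext h, ← mul_assoc, ← permElem_mul σ (ρ * adjSwap i),
      ← permElem_mul_adjSwap hsq hfar hnext, mul_assoc, mul_adjSwap_mul_adjSwap]
  · rw [eq_one_of_not_descent fun i hi => h ⟨i, hi⟩, permElem_one, mul_one, mul_one]
termination_by weight ρ

theorem permElem_mul_inv (σ : Equiv.Perm (Fin n)) : permElem T σ * permElem T σ⁻¹ = 1 := by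
  rw [← permElem_mul hsq hfar hnext, mul_inv_cancel, permElem_one]

theorem permElem_inv_mul (σ : Equiv.Perm (Fin n)) : permElem T σ⁻¹ * permElem T σ = 1 := by
  rw [← permElem_mul hsq hfar hnext, inv_mul_cancel, permElem_one]

variable {a : Fin (n - 1) → M} (haT : ∀ i, a i * T i = T i * a i)
  (haFar : ∀ i j, Far i j → a i * T j = T j * a i)
  (haNext : ∀ i j, Next i j → T i * T j * a i = a j * (T i * T j))

omit hfar hnext in
include haNext in
-- The mirror image follows by conjugation, since `T j * T i` is inverse to `T i * T j`.
theorem mul_mul_of_next_symm {i j : Fin (n - 1)} (h : Next i j) :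
    T j * T i * a j = a i * (T j * T i) := by
  have e1 : T j * T i * (T i * T j) = 1 := by
    rw [mul_assoc, ← mul_assoc (T i), hsq, one_mul, hsq]
  have e2 : T i * T j * (T j * T i) = 1 := by
    rw [mul_assoc, ← mul_assoc (T j), hsq, one_mul, hsq]
  calc T j * T i * a j = T j * T i * (a j * (T i * T j)) * (T j * T i) := by
        rw [mul_assoc (T j * T i), mul_assoc (a j), e2, mul_one]
    _ = a i * (T j * T i) := by
        rw [← haNext i j h, ← mul_assoc (T j * T i) (T i * T j), e1, one_mul]

include haT haFar haNext

/-- Induction on the weight: a descent at `i` or far from `i` passes by commutation, and a descent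
next to `i` forces a second one, so that the semivirtual relation applies. -/
theorem permElem_mul_of_pairAt {σ : Equiv.Perm (Fin n)} {i j : Fin (n - 1)}
    (h : pairAt σ i = pairAt 1 j) : permElem T σ * a i = a j * permElem T σ := by
  have desc {k : Fin (n - 1)} (hk : Descent σ k) := permElem_of_descent hfar hnext hk
  by_cases hi : Descent σ i
  · have := weight_lt hi
    rw [desc hi, mul_assoc, ← haT, ← mul_assoc,
      permElem_mul_of_pairAt (by rw [pairAt_mul_self, h]), mul_assoc]
  have hi' : σ (leftPos i) = leftPos j ∧ σ (rightPos i) = rightPos j := by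
    have h1 := σ.injective.ne (leftPos_ne_rightPos i)
    have h' : ({σ (leftPos i), σ (rightPos i)} : Set (Fin n)) = {leftPos j, rightPos j} := by
      simpa [pairAt] using congrArg (fun s : Finset (Fin n) => (s : Set (Fin n))) h
    rcases Set.pair_eq_pair_iff.1 h' with h' | h'
    · exact h'
    · refine absurd ?_ hi
      rw [Descent, h'.1, h'.2]
      simp [leftPos, rightPos]
  obtain ⟨hl, hr⟩ := hi'
  by_cases hex : ∃ k, Descent σ k
  · obtain ⟨k, hk⟩ := hex
    have w1 := weight_lt hk
    -- With `k` next to `i`, splitting off `T i * T k` turns `a i` into `a k`, and the shorter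
    -- permutation carries the pair at `k` to the pair at `j`.
    have step (hd : Descent (σ * adjSwap k) i)
        (hp : pairAt (σ * adjSwap k * adjSwap i) k = pairAt σ i)
        (hm : T i * T k * a i = a k * (T i * T k)) :
        permElem T σ * a i = a j * permElem T σ := by
      have w2 := weight_lt hd
      have w3 : weight (σ * adjSwap k * adjSwap i) < weight σ := w2.trans w1
      rw [desc hk, permElem_of_descent hfar hnext hd, mul_assoc (permElem T _), mul_assoc, hm,
        ← mul_assoc, permElem_mul_of_pairAt (hp.trans h), mul_assoc]
    rcases eq_or_far_or_next i k with rfl | hik | hik | hik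
    · exact absurd hk hi
    · rw [desc hk, mul_assoc, ← haFar i k hik, ← mul_assoc,
        permElem_mul_of_pairAt (by rw [hik.symm.pairAt_mul, h]), mul_assoc]
    -- The value at `rightPos k` is below `j + 1` and differs from `j = σ (leftPos i)`, hence is
    -- below `j`. The mirror case below is analogous.
    · refine step ((hik.descent_mul_snd_iff σ).2 ?_) ?_ (haNext i k hik)
      · have h1 := σ.injective.ne hik.leftPos_ne_rightPos
        rw [Descent, ← hik.rightPos_eq, hr] at hk
        rw [hl] at h1 ⊢
        rw [ne_eq, Fin.ext_iff] at h1
        rw [Fin.lt_def] at hk ⊢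
        simp only [leftPos, rightPos] at hk h1 ⊢
        omega
      · rw [← hik.pairAt_mul_mul, mul_adjSwap_mul_adjSwap, mul_adjSwap_mul_adjSwap]
    · refine step ((hik.descent_mul_fst_iff σ).2 ?_) (hik.pairAt_mul_mul σ)
        (mul_mul_of_next_symm hsq haNext hik)
      have h1 := σ.injective.ne hik.leftPos_ne_rightPos
      rw [Descent, hik.rightPos_eq, hl] at hk
      rw [hr] at h1 ⊢
      rw [ne_eq, Fin.ext_iff] at h1
      rw [Fin.lt_def] at hk ⊢
      simp only [leftPos, rightPos] at hk h1 ⊢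
      omega
  · have h1 := eq_one_of_not_descent fun i hi => hex ⟨i, hi⟩
    subst h1
    have : i = j := by
      have := congrArg Fin.val hl
      exact Fin.ext this
    rw [this, permElem_one, mul_one, one_mul]
termination_by weight σ

/-- The permutation `ρ⁻¹ * σ` carries the pair at `i` to the pair at `j`, so it intertwines `a i`
and `a j`. -/
theorem conj_eq_of_pairAt_eq {σ ρ : Equiv.Perm (Fin n)} {i j : Fin (n - 1)}
    (h : pairAt σ i = pairAt ρ j) :
    permElem T σ * a i * permElem T σ⁻¹ = permElem T ρ * a j * permElem T ρ⁻¹ := by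
  have h1 : pairAt (ρ⁻¹ * σ) i = pairAt 1 j := by
    rw [pairAt_mul, h, ← pairAt_mul, inv_mul_cancel]
  have h2 := permElem_mul_of_pairAt hsq hfar hnext haT haFar haNext h1
  rw [permElem_mul hsq hfar hnext] at h2
  calc permElem T σ * a i * permElem T σ⁻¹
      = permElem T ρ * (permElem T ρ⁻¹ * permElem T σ * a i) * permElem T σ⁻¹ := by
        rw [← mul_assoc, ← mul_assoc, permElem_mul_inv hsq hfar hnext, one_mul]
    _ = permElem T ρ * a j * permElem T ρ⁻¹ := by
        rw [h2, mul_assoc, mul_assoc, mul_assoc, permElem_mul_inv hsq hfar hnext, mul_one,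
          mul_assoc]

end PermElem
-- Factoring a word into crossings and a permutation
section StrongMonoid

variable {n : ℕ}

/-- Two disjoint pairs need at least four strands, and the symmetric group is 4-transitive.
Commutation for disjoint pairs thus reduces to far generators. -/
theorem exists_common_pairAt {σ ρ : Equiv.Perm (Fin n)} {i j : Fin (n - 1)}
    (h : Disjoint (pairAt σ i) (pairAt ρ j)) :
    ∃ (κ : Equiv.Perm (Fin n)) (k l : Fin (n - 1)), Far k l ∧ pairAt κ k = pairAt σ i ∧
      pairAt κ l = pairAt ρ j := by
  have h1 := σ.injective.ne (leftPos_ne_rightPos i)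
  have h2 := ρ.injective.ne (leftPos_ne_rightPos j)
  have h3 := Finset.card_le_univ (pairAt σ i ∪ pairAt ρ j)
  rw [Finset.card_union_of_disjoint h, pairAt, pairAt, Finset.card_pair h1, Finset.card_pair h2,
    Fintype.card_fin] at h3
  simp only [pairAt, Finset.disjoint_insert_left, Finset.disjoint_singleton_left,
    Finset.mem_insert, Finset.mem_singleton, not_or] at h
  obtain ⟨⟨h4, h5⟩, h6, h7⟩ := h
  let x : Fin 4 ↪ Fin n := Fin.castLEEmb h3
  let y : Fin 4 ↪ Fin n :=
    ⟨![σ (leftPos i), σ (rightPos i), ρ (leftPos j), ρ (rightPos j)], by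
      intro p q hpq
      fin_cases p <;> fin_cases q <;>
        simp_all [Ne.symm h1, Ne.symm h2, Ne.symm h4, Ne.symm h5, Ne.symm h6, Ne.symm h7]⟩
  have := Equiv.Perm.isMultiplyPretransitive (Fin n) 4
  obtain ⟨κ, hκ⟩ := MulAction.exists_smul_eq (Equiv.Perm (Fin n)) x y
  have e (m : Fin 4) : κ (x m) = y m := by rw [← hκ]; rfl
  -- The generators with indices 0 and 2 act on the positions 0, 1 and 2, 3.
  refine ⟨κ, ⟨0, by omega⟩, ⟨2, by omega⟩, Or.inl (le_refl 2), ?_, ?_⟩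
  · exact congrArg₂ (fun s t => ({s, t} : Finset (Fin n))) (e 0) (e 1)
  · exact congrArg₂ (fun s t => ({s, t} : Finset (Fin n))) (e 2) (e 3)

variable {M : Type*} [Monoid M] {T a : Fin (n - 1) → M}
  (hsq : ∀ i, T i * T i = 1) (hfar : ∀ i j, Far i j → T i * T j = T j * T i)
  (hnext : ∀ i j, Next i j → T i * T j * T i = T j * T i * T j)
  (haT : ∀ i, a i * T i = T i * a i)
  (haFar : ∀ i j, Far i j → a i * T j = T j * a i)
  (haNext : ∀ i j, Next i j → T i * T j * a i = a j * (T i * T j))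
  (haa : ∀ i j, Far i j → a i * a j = a j * a i)

variable (T a) in
open Classical in
/-- The element of the monoid which corresponds to a classical crossing of two strands. -/
noncomputable def pairElem (s : Finset (Fin n)) : M :=
  if h : ∃ x : Equiv.Perm (Fin n) × Fin (n - 1), s = pairAt x.1 x.2 then
    permElem T h.choose.1 * a h.choose.2 * permElem T h.choose.1⁻¹
  -- Finsets not of the form `pairAt σ i` are not crossings; the value 1 makes commutation hold for
  -- them as well.
  else 1

include hsq hfar hnext haT haFar haNext

theorem pairElem_pairAt (σ : Equiv.Perm (Fin n)) (i : Fin (n - 1)) :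
    pairElem T a (pairAt σ i) = permElem T σ * a i * permElem T σ⁻¹ := by
  have h : ∃ x : Equiv.Perm (Fin n) × Fin (n - 1), pairAt σ i = pairAt x.1 x.2 := ⟨(σ, i), rfl⟩
  rw [pairElem, dif_pos h]
  exact conj_eq_of_pairAt_eq hsq hfar hnext haT haFar haNext h.choose_spec.symm

include haa in
theorem pairElem_comm (s t : Finset (Fin n)) (h : Disjoint s t) :
    pairElem T a s * pairElem T a t = pairElem T a t * pairElem T a s := by
  by_cases hs : ∃ x : Equiv.Perm (Fin n) × Fin (n - 1), s = pairAt x.1 x.2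
  · by_cases ht : ∃ x : Equiv.Perm (Fin n) × Fin (n - 1), t = pairAt x.1 x.2
    · obtain ⟨⟨σ, i⟩, rfl⟩ := hs
      obtain ⟨⟨ρ, j⟩, rfl⟩ := ht
      obtain ⟨κ, k, l, hkl, h1, h2⟩ := exists_common_pairAt h
      have key (x y : M) : permElem T κ * x * permElem T κ⁻¹ * (permElem T κ * y * permElem T κ⁻¹) =
          permElem T κ * (x * y) * permElem T κ⁻¹ := by
        have := permElem_inv_mul hsq hfar hnext κ
        rw [mul_assoc, ← mul_assoc (permElem T κ⁻¹), ← mul_assoc (permElem T κ⁻¹), this, one_mul]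
        simp only [mul_assoc]
      dsimp only at h1 h2 ⊢
      rw [← h1, ← h2, pairElem_pairAt hsq hfar hnext haT haFar haNext,
        pairElem_pairAt hsq hfar hnext haT haFar haNext, key, key, haa k l hkl]
    · rw [pairElem.eq_def T a t, dif_neg ht, mul_one, one_mul]
  · rw [pairElem.eq_def T a s, dif_neg hs, mul_one, one_mul]

/-- Any word is the product of its crossings and its permutation. -/
theorem permElem_mul_map (φ : FreeMonoid (Letter n) →* M)
    (hT : ∀ i, φ (FreeMonoid.of (tau i)) = T i) (hZ : ∀ i, φ (FreeMonoid.of (zeta i)) = a i * T i)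
    (σ : Equiv.Perm (Fin n)) (w : Word n) :
    permElem T σ * φ (FreeMonoid.ofList w) =
      ((crossings σ w).map (pairElem T a)).prod * permElem T (σ * strandAt w) := by
  induction w generalizing σ with
  | nil => simp [crossings, strandAt_nil]
  | cons l w ih =>
    have e := permElem_mul_adjSwap hsq hfar hnext
    rw [FreeMonoid.ofList_cons, map_mul, strandAt_cons]
    cases l with
    | zeta i =>
      -- As `zeta i` maps to `a i * T i`, the conjugate of `a i` splits off on the left and `T i` is
      -- absorbed into the permutation.
      have h := pairElem_pairAt hsq hfar hnext haT haFar haNext σ i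
      rw [crossings, List.map_cons, List.prod_cons, mul_assoc, swap_zeta, ← mul_assoc σ, ← ih, e,
        h, hZ, mul_assoc _ (permElem T σ⁻¹), mul_assoc (permElem T σ) (T i),
        ← mul_assoc (permElem T σ⁻¹), permElem_inv_mul hsq hfar hnext, one_mul]
      simp only [mul_assoc]
    | tau i => rw [crossings, swap_tau, ← mul_assoc σ, ← ih, e, hT, mul_assoc]

end StrongMonoid

/-! ### Strong equivalence of irreducible words -/

section Main

variable {n : ℕ}

theorem StrongMove.append_left (A : Word n) {u v : Word n} (h : StrongMove u v) :
    StrongMove (A ++ u) (A ++ v) := by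
  obtain ⟨A', x, y, C, h, rfl, rfl⟩ := h
  exact ⟨A ++ A', x, y, C, h, by simp, by simp⟩

theorem StrongMove.append_right (C : Word n) {u v : Word n} (h : StrongMove u v) :
    StrongMove (u ++ C) (v ++ C) := by
  obtain ⟨A, x, y, C', h, rfl, rfl⟩ := h
  exact ⟨A, x, y, C' ++ C, h, by simp, by simp⟩

theorem StronglyEquivalent.map {f : Word n → Word n}
    (hf : ∀ u v, StrongMove u v → StrongMove (f u) (f v)) {u v : Word n}
    (h : StronglyEquivalent u v) : StronglyEquivalent (f u) (f v) := by
  induction h with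
  | rel _ _ h => exact .rel _ _ (hf _ _ h)
  | refl _ => exact .refl _
  | symm _ _ _ ih => exact ih.symm
  | trans _ _ _ _ _ ih ih' => exact ih.trans _ _ _ ih'

/-- Strong equivalence as a congruence. -/
def strongCon (n : ℕ) : Con (FreeMonoid (Letter n)) where
  r u v := StronglyEquivalent u.toList v.toList
  iseqv := ⟨fun _ => .refl _, fun h => h.symm, fun h h' => h.trans _ _ _ h'⟩
  mul' := by
    intro u u' v v' h h'
    simp only [FreeMonoid.toList_mul]
    exact (h.map fun _ _ => StrongMove.append_right _).trans _ _ _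
      (h'.map fun _ _ => StrongMove.append_left _)

theorem mk_eq_of_strongRel {u v : Word n} (h : StrongRel n u v) :
    (strongCon n).mk' (FreeMonoid.ofList u) = (strongCon n).mk' (FreeMonoid.ofList v) :=
  (Con.eq _).2 (.rel _ _ ⟨[], u, v, [], h, by simp, by simp⟩)

/-- Words with the same permutation and equivalent lists of crossings are strongly equivalent. -/
theorem stronglyEquivalent_of_crossings {w w' : Word n} (h : strandAt w = strandAt w')
    (h' : TraceEq Disjoint (crossings 1 w) (crossings 1 w')) : StronglyEquivalent w w' := by
  set φ := (strongCon n).mk' with hφ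
  have rel {u v : Word n} (h : StrongRel n u v) :
      φ (FreeMonoid.ofList u) = φ (FreeMonoid.ofList v) := mk_eq_of_strongRel h
  let T (i : Fin (n - 1)) := φ (FreeMonoid.of (tau i))
  let Z (i : Fin (n - 1)) := φ (FreeMonoid.of (zeta i))
  -- The factor `T i` cancels the transposition made by `Z i`, so `a i` records a crossing without
  -- permuting positions.
  let a (i : Fin (n - 1)) := Z i * T i
  have hsq (i) : T i * T i = 1 := rel (.virtualSecond i)
  have hfar (i j) (h : Far i j) : T i * T j = T j * T i := rel (.farTauTau i j h)
  have hnext (i j) (h : Next i j) : T i * T j * T i = T j * T i * T j := by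
    have := rel (.virtualThird i j h)
    simpa [FreeMonoid.ofList_cons, mul_assoc, T] using this
  have hZT (i) : Z i * T i = T i * Z i := rel (.virtualization i)
  have hZfar (i j) (h : Far i j) : Z i * T j = T j * Z i := rel (.farZetaTau i j h)
  have hZZ (i j) (h : Far i j) : Z i * Z j = Z j * Z i := rel (.farZetaZeta i j h)
  have hZnext (i j) (h : Next i j) : T i * T j * Z i = Z j * T i * T j := by
    have := rel (.semivirtualThird i j h)
    simpa [FreeMonoid.ofList_cons, mul_assoc, T, Z] using this
  have haT (i) : a i * T i = T i * a i := by
    change Z i * T i * T i = T i * (Z i * T i)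
    rw [hZT, mul_assoc, hZT]
  have haFar (i j) (h : Far i j) : a i * T j = T j * a i := by
    change Z i * T i * T j = T j * (Z i * T i)
    rw [mul_assoc, hfar i j h, ← mul_assoc, hZfar i j h, mul_assoc]
  have haNext (i j) (h : Next i j) : T i * T j * a i = a j * (T i * T j) := by
    change T i * T j * (Z i * T i) = Z j * T j * (T i * T j)
    rw [← mul_assoc, hZnext i j h, mul_assoc (Z j), mul_assoc (Z j), hnext i j h, mul_assoc (Z j),
      mul_assoc (T j)]
  have haa (i j) (h : Far i j) : a i * a j = a j * a i := by
    have hc : Commute (Z i * T i) (Z j * T j) :=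
      Commute.mul_left (Commute.mul_right (hZZ i j h) (hZfar i j h))
        (Commute.mul_right (hZfar j i h.symm).symm (hfar i j h))
    exact hc
  have hZ (i) : φ (FreeMonoid.of (zeta i)) = a i * T i := by
    change Z i = Z i * T i * T i
    rw [mul_assoc, hsq, mul_one]
  have key := permElem_mul_map hsq hfar hnext haT haFar haNext φ (fun _ => rfl) hZ 1
  have e : φ (FreeMonoid.ofList w) = φ (FreeMonoid.ofList w') := by
    rw [← one_mul (φ (FreeMonoid.ofList w)), ← one_mul (φ (FreeMonoid.ofList w')),
      ← permElem_one T, key, key, h,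
      h'.prod_map _ (pairElem_comm hsq hfar hnext haT haFar haNext haa)]
  exact (Con.eq _).1 e

/-- Irreducible words which represent the same element of `F n` are strongly equivalent. -/
theorem IsIrreducible.stronglyEquivalent {w w' : Word n} (h : IsIrreducible w)
    (h' : IsIrreducible w') (e : crossingCon n (FreeMonoid.ofList w) (FreeMonoid.ofList w')) :
    StronglyEquivalent w w' := by
  refine stronglyEquivalent_of_crossings e.1 ?_
  have := e.2 1 [] trivial
  rwa [FreeMonoid.toList_ofList, FreeMonoid.toList_ofList, h.reduced.normalize_nil,
    h'.reduced.normalize_nil] at this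

end Main

end FreeBraid

theorem mainTheorem4 (n : ℕ) (B : Set (FreeBraid.FB n)) (p : FreeBraid.Parity B)
    (β : FreeBraid.Word n) (hβ : FreeBraid.toFB β ∈ B) (hodd : p.AllOdd β)
    (hirr : FreeBraid.IsIrreducible β) (β' : FreeBraid.Word n)
    (heq : FreeBraid.toFB β' = FreeBraid.toFB β) :
    ∃ γ : FreeBraid.Word n, γ.Sublist β' ∧ FreeBraid.StronglyEquivalent γ β := by
  have h1 := FreeBraid.toF_keepOdd_eq p heq (heq ▸ hβ)
  have h2 : FreeBraid.keepOdd p.val [] β [] = β := by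
    refine FreeBraid.keepOdd_eq_self _ _ fun w₁ k w₂ h => ?_
    rw [List.nil_append, List.append_nil, hodd w₁ k w₂ h]
    decide
  rw [h2] at h1
  obtain ⟨γ, hγ, hγ', hc⟩ := FreeBraid.exists_irreducible (FreeBraid.keepOdd p.val [] β' [])
  have h3 := FreeBraid.con_of_toF_eq _ (fun _ _ => FreeBraid.crossingCon_of_rel) h1
  exact ⟨γ, hγ.trans (FreeBraid.keepOdd_sublist _ _ _ _), hγ'.stronglyEquivalent hirr
    ((FreeBraid.crossingCon n).trans ((FreeBraid.crossingCon n).symm hc) h3)⟩
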